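/- There are absolute constants $C, C' > 0$ with the following property. Let $P$ be the transition matrix of an ergodic (irreducible and aperiodic) Markov chain on a finite set $X$ that is reversible with respect to its stationary distribution $\pi$, and let $v\in X$ be a marked node with $\pi_v\le 1/2$. Let $HT(P,v)=\max_{x\in X}\mathbb{E}_x[\tau_v]$ be the hitting time of $v$, where $\tau_v$ is the first time at which the walk is in $v$ (worst-case starting node). Let $P'$ be the chain obtained from $P$ by replacing all outgoing edges of $v$ by a self-loop, $P(s)=(1-s)P+sP'$, and $s^*=1-\pi_v/(1-\pi_v)\in[0,1]$. Let $\mathcal H=\mathbb{C}^X$ with basis $|x\rangle$, $x\in X$, let $|0\rangle\in\mathcal H$ be a fixed unit vector (the reference state), and let $V$ be any unitary on $\mathcal H\otimes\mathcal H$ with $V|x,0\rangle=\sum_y\sqrt{p_{xy}(s^*)}\,|x,y\rangle$ for all $x$. Let $S|x,y\rangle=|y,x\rangle$ if $p_{xy}>0$ and $S|x,y\rangle=|x,y\rangle$ otherwise, let $\Pi_0=I\otimes|0\rangle\langle 0|$, and let $H=H(s^*)=i[V^\dagger S V,\Pi_0]$. Put $|\psi_0\rangle=|\pi(0),0\rangle=\sum_x\sqrt{\pi_x}\,|x,0\rangle$.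 Let $\varepsilon\in(0,1/4)$, $k=\lceil\log_2(1/\varepsilon)\rceil$ and $T=C\sqrt{HT(P,v)}$. Then $HT(P,v)<\infty$, $T>0$, and if $t_1,\dots,t_k$ are independent and uniformly distributed in $[0,T]$, then measuring the first register of $e^{-iH(t_1+\cdots+t_k)}|\psi_0\rangle$ in the basis $\{|x\rangle\}$ yields $v$ with average probability $$\mathbb{E}_{t_1,\dots,t_k}\Big[\sum_{y\in X}\big|\langle v,y|e^{-iH(t_1+\cdots+t_k)}|\psi_0\rangle\big|^2\Big]\ \ge\ \frac14-\varepsilon ,$$ and the maximal total evolution time satisfies $kT\le C'\sqrt{HT(P,v)}\,\log(1/\varepsilon)$. -/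

import Mathlib

open MeasureTheory ProbabilityTheory
open scoped ENNReal Kronecker

noncomputable section

namespace QSearch

variable {X : Type*} [Fintype X] [DecidableEq X]

/-! ### The classical walk and its hitting time -/

section Classical

variable [MeasurableSpace X] [DiscreteMeasurableSpace X]

/-- The law of one step of the Markov chain `P` from the state `x`. -/
def rowPMF (P : Matrix X X ℝ) (hP : P ∈ Matrix.rowStochastic ℝ X) (x : X) : PMF X :=
  PMF.ofFintype (fun y => ENNReal.ofReal (P x y)) (by
    have h := Matrix.mem_rowStochastic_iff_sum.1 hP
    rw [← ENNReal.ofReal_sum_of_nonneg (fun y _ => h.1 x y), h.2 x, ENNReal.ofReal_one])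

/-- The transition kernel of the Markov chain `P`. -/
def stepKernel (P : Matrix X X ℝ) (hP : P ∈ Matrix.rowStochastic ℝ X) : Kernel X X :=
  Kernel.ofFunOfCountable fun x => (rowPMF P hP x).toMeasure

instance (P : Matrix X X ℝ) (hP : P ∈ Matrix.rowStochastic ℝ X) :
    IsMarkovKernel (stepKernel P hP) :=
  ⟨fun x => PMF.toMeasure.isProbabilityMeasure (rowPMF P hP x)⟩

/-- The kernel that draws the state at time `n + 1` from the states at the times `0, …, n`;
it depends only on the state at time `n`. -/
def historyKernel (P : Matrix X X ℝ) (hP : P ∈ Matrix.rowStochastic ℝ X) (n : ℕ) :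
    Kernel (∀ _ : Finset.Iic n, X) X :=
  (stepKernel P hP).comap (fun h => h ⟨n, Finset.mem_Iic.2 le_rfl⟩) (measurable_pi_apply _)

instance (P : Matrix X X ℝ) (hP : P ∈ Matrix.rowStochastic ℝ X) (n : ℕ) :
    IsMarkovKernel (historyKernel P hP n) := by
  unfold historyKernel; infer_instance

/-- The law of the trajectory `(ω₀, ω₁, …)` of the Markov chain `P` started at `ω₀ = x`. -/
def chainLaw (P : Matrix X X ℝ) (hP : P ∈ Matrix.rowStochastic ℝ X) (x : X) :
    Measure (ℕ → X) :=
  Kernel.traj (X := fun _ => X) (historyKernel P hP) 0 (fun _ => x)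

/-- The expected number of steps that the Markov chain `P` started at `x` needs to reach `v`. -/
def expectedHittingTime (P : Matrix X X ℝ) (hP : P ∈ Matrix.rowStochastic ℝ X) (v x : X) :
    ℝ≥0∞ :=
  ∫⁻ ω, ENat.toENNReal (hittingAfter (fun (n : ℕ) (ω : ℕ → X) => ω n) {v} 0 ω)
    ∂(chainLaw P hP x)

/-- The hitting time `HT(P, v)`: the expected number of steps to reach `v` from a worst-case
starting state. -/
def hittingTime (P : Matrix X X ℝ) (hP : P ∈ Matrix.rowStochastic ℝ X) (v : X) : ℝ≥0∞ :=
  ⨆ x, expectedHittingTime P hP v x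

end Classical

/-! ### Interpolated chains -/

/-- The absorbing chain `P'`: the outgoing edges of `v` are replaced by a self-loop. -/
def absorbing (P : Matrix X X ℝ) (v : X) : Matrix X X ℝ :=
  P.updateRow v (Pi.single v 1)

/-- The interpolated chain `P(s) = (1 - s) P + s P'`. -/
def interpolated (P : Matrix X X ℝ) (v : X) (s : ℝ) : Matrix X X ℝ :=
  (1 - s) • P + s • absorbing P v

/-! ### The search Hamiltonian on `ℋ ⊗ ℋ`, with `ℋ` spanned by the states

Vectors of `ℋ` and of `ℋ ⊗ ℋ` are given by their coordinates in the bases `|x⟩` and `|x, y⟩`;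
`r` is the reference state `|0⟩` of `ℋ`. -/

/-- The product vector `|φ⟩ ⊗ |r⟩`. -/
def tensorKet (φ r : X → ℂ) : X × X → ℂ := fun p => φ p.1 * r p.2

/-- `V` is a unitary on `ℋ ⊗ ℋ` with `V |x, 0⟩ = ∑ y, √(Q x y) |x, y⟩` for every state `x`. -/
def IsWalkUnitary (Q : Matrix X X ℝ) (r : X → ℂ) (V : Matrix (X × X) (X × X) ℂ) : Prop :=
  V ∈ Matrix.unitaryGroup (X × X) ℂ ∧
    ∀ x, V.mulVec (tensorKet (Pi.single x 1) r) =
      ∑ y, ((Real.sqrt (Q x y) : ℝ) : ℂ) • (Pi.single (x, y) 1 : X × X → ℂ)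

open Classical in
/-- The swap `S`: `S |x, y⟩` is `|y, x⟩` if `(x, y)` is an edge of `P`, and `|x, y⟩` otherwise. -/
def edgeSwap (P : Matrix X X ℝ) : Matrix (X × X) (X × X) ℂ :=
  Matrix.of fun a b => if a = (if 0 < P b.1 b.2 then (b.2, b.1) else b) then 1 else 0

/-- The projection `Π₀ = I ⊗ |0⟩⟨0|`. -/
def refProj (r : X → ℂ) : Matrix (X × X) (X × X) ℂ :=
  (1 : Matrix X X ℂ) ⊗ₖ Matrix.vecMulVec r (star r)

/-- The search Hamiltonian `H = i [V† S V, Π₀]`. -/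
def searchHamiltonian (P : Matrix X X ℝ) (r : X → ℂ) (V : Matrix (X × X) (X × X) ℂ) :
    Matrix (X × X) (X × X) ℂ :=
  Complex.I • ⁅V.conjTranspose * edgeSwap P * V, refProj r⁆

/-! ### The walk with random evolution time -/

/-- The probability to read `v` in the first register after evolving `ψ` under `H` for a
time `t`. -/
def successProb (H : Matrix (X × X) (X × X) ℂ) (ψ : X × X → ℂ) (v : X) (t : ℝ) : ℝ :=
  ∑ y, ‖(NormedSpace.exp (-(Complex.I * (t : ℂ)) • H)).mulVec ψ (v, y)‖ ^ 2

/-- The expectation of `successProb` at the time `t₁ + ⋯ + t_k`, for independent `t_j` that are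
uniformly distributed in `[0, T]`. -/
def avgSuccessProb (H : Matrix (X × X) (X × X) ℂ) (ψ : X × X → ℂ) (v : X) (k : ℕ) (T : ℝ) : ℝ :=
  ∫ t : Fin k → ℝ, successProb H ψ v (∑ j, t j)
    ∂(Measure.pi fun _ => ProbabilityTheory.cond volume (Set.Icc 0 T))

end QSearch

end

/-!
The search evolution `exp (-i H t)` is `exp (t B)` with the anti-Hermitian generator
`B = [V† S V, Π₀]`. Since `(V† S V)² = 1` and the compression of `V† S V` to the reference subspace
`ℋ ⊗ |0⟩` is the discriminant matrix `D x y = √(Q x y Q y x)` of the interpolated chain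
`Q = P(s*)`, one has `B² |φ, 0⟩ = -(1 - λ²) |φ, 0⟩` for every eigenvector `D φ = λ φ`, and `B |φ, 0⟩`
is orthogonal to the reference subspace (`generator_mulVec_eigen`). Hence the component of
`exp (t B) |φ, 0⟩` in that subspace is `cos (θ t) |φ, 0⟩` with `θ = √(1 - λ²)`
(`contract_exp_mulVec`), while the stationary state `|√σ, 0⟩` of `Q` does not move.

At `s = s*` the stationary distribution `σ` of `Q` gives the marked node the weight `1/2`. The
initial state is `a |√σ⟩ + b |z⟩`, where `z = √2 |v⟩ - |√σ⟩` is the unit vector orthogonal to `|√σ⟩`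
in the plane of `|√σ⟩` and `|v⟩`. The part along `|√σ⟩` alone contributes
`a² / 2 = 1/4 + √(π v (1 - π v)) / 2` to the success probability, the part along `z` a nonnegative
amount, and the interference of the two equals `-(1 - 2 π v) / 2` times `∑ ζ_n² cos (θ_n t)`, where
`ζ_n = ⟨φ_n, z⟩` (`le_successProb`). Averaging `cos (θ t)` over the random time gives the real part
of `χ (θ T) ^ k`, with `χ` the characteristic function of the uniform distribution on `[0, 1]`; its
absolute value is at most `2 ^ (-k) ≤ ε` once `θ T ≥ 4`. It remains to control the eigenvalues near `±1`.

* Near `1`: the expected hitting times `h` solve `h = 1 + P h` off `v`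
  (`exists_hittingTime_potential`), so that `h + 1 ≤ HT + 1` is a strictly superharmonic function off
  `v`. Barta's inequality (`IsReversible.barta`) then bounds the Dirichlet form of functions vanishing
  at `v`, hence the gap: `1 - λ ≥ 1 / (HT + 1)` for every `φ_n` with `ζ_n ≠ 0`
  (`IsReversible.gap`, `IsEigenbasis.of_overlap_ne_zero`). It matters here that `HT` is the hitting
  time from a worst-case starting node.
* Near `-1`: the chain is not assumed to be lazy, and `λ` may come arbitrarily close to `-1`. But
  the loop of weight at least `s*` that the interpolation creates at `v` limits the weight of
  `|v⟩` on the eigenvalues below `-1 + δ` to `δ / (2 s*)`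
  (`IsEigenbasis.two_mul_loop_mul_sum_le`). With `δ = 1 / (4 HT)` and `1 - 2 π v = s* (1 - π v)` these
  eigenvalues cost at most `1 / (8 HT)`. The surplus `√(π v (1 - π v)) / 2` of the stationary part
  covers this cost, because `π v ≥ 1 / (2 HT)` by averaging `h = 1 + P h` against `π`
  (`one_sub_stationary_le`).
-/

noncomputable section

namespace QSearch

/-! ### The classical walk: first-step analysis of the hitting time -/

section Classical

variable {X : Type*} [Fintype X] [DecidableEq X]
  [MeasurableSpace X] [DiscreteMeasurableSpace X]

lemma lintegral_stepKernel (P : Matrix X X ℝ) (hP : P ∈ Matrix.rowStochastic ℝ X) (x : X)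
    (g : X → ℝ≥0∞) :
    ∫⁻ y, g y ∂(stepKernel P hP x) = ∑ y, ENNReal.ofReal (P x y) * g y := by
  rw [lintegral_fintype]
  refine Finset.sum_congr rfl fun y _ => ?_
  rw [mul_comm]
  congr 1
  change (rowPMF P hP x).toMeasure {y} = _
  rw [PMF.toMeasure_apply_singleton _ _ (MeasurableSet.singleton y)]
  rfl

/-- The Markov property at time `n`, for functionals of the past and of the next state. -/
lemma lintegral_chainLaw_succ (P : Matrix X X ℝ) (hP : P ∈ Matrix.rowStochastic ℝ X) (x : X)
    (n : ℕ) (F : (∀ _ : Finset.Iic n, X) → ℝ≥0∞) (g : X → ℝ≥0∞) :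
    ∫⁻ ω, F (Preorder.frestrictLe (π := fun _ => X) n ω) * g (ω (n + 1)) ∂(chainLaw P hP x) =
      ∫⁻ ω, F (Preorder.frestrictLe (π := fun _ => X) n ω) *
        ∑ y, ENNReal.ofReal (P (ω n) y) * g y ∂(chainLaw P hP x) := by
  have hF : Measurable F := measurable_of_finite F
  have hg : Measurable g := measurable_of_finite g
  have h1 := Kernel.partialTraj_compProd_traj (X := fun _ => X) (κ := historyKernel P hP)
    (Nat.zero_le n) (fun _ => x)
  have h2 : ∀ z : (∀ _ : Finset.Iic n, X),
      ∫⁻ ω, g (ω (n + 1)) ∂(Kernel.traj (X := fun _ => X) (historyKernel P hP) n z) =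
        ∑ y, ENNReal.ofReal (P (z ⟨n, Finset.mem_Iic.2 le_rfl⟩) y) * g y := by
    intro z
    rw [← lintegral_stepKernel P hP]
    have h3 := Kernel.map_traj_succ_self (X := fun _ => X) (κ := historyKernel P hP) (a := n)
    have h4 : (Kernel.traj (X := fun _ => X) (historyKernel P hP) n z).map
        (fun ω : ℕ → X => ω (n + 1)) = historyKernel P hP n z := by
      rw [← h3, Kernel.map_apply _ (by fun_prop)]
    change _ = ∫⁻ y, g y ∂(historyKernel P hP n z)
    rw [← h4, lintegral_map hg (by fun_prop)]
  have h5 : ∫⁻ ω, F (Preorder.frestrictLe (π := fun _ => X) n ω) * g (ω (n + 1))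
        ∂(chainLaw P hP x) =
      ∫⁻ p : (∀ _ : Finset.Iic n, X) × (ℕ → X), F p.1 * g (p.2 (n + 1))
        ∂((Kernel.traj (X := fun _ => X) (historyKernel P hP) 0 (fun _ => x)).map
          (fun ω => (Preorder.frestrictLe (π := fun _ => X) n ω, ω))) := by
    rw [lintegral_map (by fun_prop) (by fun_prop)]
    rfl
  rw [h5, ← h1, Measure.lintegral_compProd (by fun_prop)]
  have h6 := Kernel.traj_map_frestrictLe_apply (X := fun _ => X) (κ := historyKernel P hP)
    0 n (fun _ => x)
  rw [← h6, lintegral_map (measurable_of_finite _) (by fun_prop)]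
  refine lintegral_congr fun ω => ?_
  change ∫⁻ η : ℕ → X, F (Preorder.frestrictLe (π := fun _ => X) n ω) * g (η (n + 1)) ∂_ = _
  rw [lintegral_const_mul _ (by fun_prop), h2]
  rfl

lemma lintegral_chainLaw_zero (P : Matrix X X ℝ) (hP : P ∈ Matrix.rowStochastic ℝ X) (x : X)
    (g : X → ℝ≥0∞) : ∫⁻ ω, g (ω 0) ∂(chainLaw P hP x) = g x := by
  have hg : Measurable g := measurable_of_finite g
  have h6 := Kernel.traj_map_frestrictLe_apply (X := fun _ => X) (κ := historyKernel P hP)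
    0 0 (fun _ => x)
  have : ∫⁻ ω, g (ω 0) ∂(chainLaw P hP x) =
      ∫⁻ z, g (z ⟨0, Finset.mem_Iic.2 le_rfl⟩) ∂((chainLaw P hP x).map
        (Preorder.frestrictLe (π := fun _ => X) 0)) := by
    rw [lintegral_map (by fun_prop) (by fun_prop)]
    rfl
  rw [this, chainLaw, h6, Kernel.partialTraj_self, Kernel.id_apply,
    lintegral_dirac' _ (by fun_prop)]

/-- The transition matrix of the walk killed on entering `v`: the column of `v` is replaced
by zeros. -/
def killed (P : Matrix X X ℝ) (v : X) : Matrix X X ℝ :=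
  Matrix.of fun x y => if y = v then 0 else P x y

omit [MeasurableSpace X] [DiscreteMeasurableSpace X] in
lemma killed_pow_mulVec_nonneg {P : Matrix X X ℝ} (hP : P ∈ Matrix.rowStochastic ℝ X) (v : X)
    (n : ℕ) {g : X → ℝ} (hg : 0 ≤ g) : 0 ≤ ((killed P v) ^ n).mulVec g := by
  induction n with
  | zero => simpa using hg
  | succ n ih =>
    rw [pow_succ', ← Matrix.mulVec_mulVec]
    intro x
    refine Finset.sum_nonneg fun y _ => mul_nonneg ?_ (ih y)
    simp only [killed, Matrix.of_apply]
    split_ifs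
    · exact le_rfl
    · exact hP.1 x y

/-- The law of the state at time `n`, on the event that `v` has not been visited up to then, is
given by the powers of the killed matrix. -/
lemma lintegral_avoid (P : Matrix X X ℝ) (hP : P ∈ Matrix.rowStochastic ℝ X) (v x : X)
    (n : ℕ) : ∀ g : X → ℝ, 0 ≤ g →
    ∫⁻ ω, (∏ i : Finset.Iic n, if ω i = v then 0 else 1) * ENNReal.ofReal (g (ω n))
        ∂(chainLaw P hP x) =
      if x = v then 0 else ENNReal.ofReal (((killed P v) ^ n).mulVec g x) := by
  induction n with
  | zero =>
    intro g hg
    have := lintegral_chainLaw_zero P hP x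
      (fun y => (if y = v then 0 else 1) * ENNReal.ofReal (g y))
    simp only [pow_zero, Matrix.one_mulVec]
    convert this using 1
    · refine lintegral_congr fun ω => ?_
      congr 1
      rw [Finset.prod_coe_sort (Finset.Iic 0) (fun i => if ω i = v then (0 : ℝ≥0∞) else 1)]
      simp [show Finset.Iic 0 = {0} from rfl]
    · simp
  | succ n ih =>
    intro g hg
    have h1 := lintegral_chainLaw_succ P hP x n (fun z => ∏ i, if z i = v then 0 else 1)
      (fun y => (if y = v then 0 else 1) * ENNReal.ofReal (g y))
    have h2 : ∀ x, ∑ y, ENNReal.ofReal (P x y) * ((if y = v then 0 else 1) * ENNReal.ofReal (g y))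
        = ENNReal.ofReal ((killed P v).mulVec g x) := by
      intro x
      rw [Matrix.mulVec, dotProduct, ENNReal.ofReal_sum_of_nonneg]
      · refine Finset.sum_congr rfl fun y _ => ?_
        by_cases h : y = v
        · simp [h, killed]
        · simp [h, killed, ENNReal.ofReal_mul (hP.1 x y)]
      · intro y _
        refine mul_nonneg ?_ (hg y)
        simp only [killed, Matrix.of_apply]
        split_ifs
        · exact le_rfl
        · exact hP.1 x y
    rw [pow_succ, ← Matrix.mulVec_mulVec,
      ← ih _ (by simpa using killed_pow_mulVec_nonneg hP v 1 hg)]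
    convert h1 using 1
    · refine lintegral_congr fun ω => ?_
      rw [← mul_assoc]
      congr 1
      rw [Finset.prod_coe_sort (Finset.Iic (n+1)) (fun i => if ω i = v then (0 : ℝ≥0∞) else 1)]
      change _ = (∏ i : Finset.Iic n, if ω i = v then (0 : ℝ≥0∞) else 1) *
        if ω (n + 1) = v then 0 else 1
      rw [Finset.prod_coe_sort (Finset.Iic n) (fun i => if ω i = v then (0 : ℝ≥0∞) else 1),
        show Finset.Iic (n + 1) = insert (n + 1) (Finset.Iic n) by ext; simp; omega,
        Finset.prod_insert (by simp), mul_comm]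
    · refine lintegral_congr fun ω => ?_
      rw [h2]
      rfl

omit [Fintype X] [MeasurableSpace X] [DiscreteMeasurableSpace X] in
/-- A hitting time counts the times up to which `v` has not been visited. -/
lemma toENNReal_hittingAfter (v : X) (ω : ℕ → X) :
    ENat.toENNReal (hittingAfter (fun (n : ℕ) (ω : ℕ → X) => ω n) {v} 0 ω) =
      ∑' n : ℕ, ∏ i : Finset.Iic n, if ω i = v then 0 else 1 := by
  have h0 : ∀ n : ℕ, (∏ i : Finset.Iic n, if ω i = v then (0 : ℝ≥0∞) else 1) =
      if ∀ i ≤ n, ω i ≠ v then 1 else 0 := by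
    intro n
    rw [Finset.prod_coe_sort (Finset.Iic n) (fun i => if ω i = v then (0 : ℝ≥0∞) else 1)]
    split_ifs with h
    · refine Finset.prod_eq_one fun i hi => ?_
      simp [h i (Finset.mem_Iic.1 hi)]
    · push Not at h
      obtain ⟨i, hi, hv⟩ := h
      exact Finset.prod_eq_zero (Finset.mem_Iic.2 hi) (by simp [hv])
  simp_rw [h0]
  by_cases hex : ∃ j, ω j = v
  · have hm := Nat.sInf_mem (s := {i | ω i = v}) hex
    set m := sInf {i | ω i = v} with hmdef
    have h1 : hittingAfter (fun (n : ℕ) (ω : ℕ → X) => ω n) {v} 0 ω = ((m : ℕ) : ℕ∞) := by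
      rw [hittingAfter, if_pos (by simpa using hex)]
      simp [m]; rfl
    have h2 : ∀ n, (∀ i ≤ n, ω i ≠ v) ↔ n < m := by
      intro n
      constructor
      · intro h
        by_contra hlt
        exact h m (not_lt.1 hlt) hm
      · intro h i hi hv
        exact absurd (Nat.sInf_le (s := {i | ω i = v}) hv) (not_le.2 (lt_of_le_of_lt hi h))
    simp_rw [h1, h2]
    rw [tsum_eq_sum (s := Finset.range m) (by intro n hn; simpa using hn)]
    rw [Finset.sum_congr rfl (g := fun _ => (1 : ℝ≥0∞))
      (by intro n hn; simp [Finset.mem_range.1 hn])]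
    simp
  · push Not at hex
    have h1 : hittingAfter (fun (n : ℕ) (ω : ℕ → X) => ω n) {v} 0 ω = (⊤ : ℕ∞) := by
      rw [hittingAfter, if_neg (by simpa using hex)]
      rfl
    simp [h1, hex]

/-- The tail-sum formula for the expected hitting time. -/
lemma expectedHittingTime_eq_tsum (P : Matrix X X ℝ) (hP : P ∈ Matrix.rowStochastic ℝ X)
    (v x : X) : expectedHittingTime P hP v x =
      if x = v then 0 else ∑' n : ℕ, ENNReal.ofReal (((killed P v) ^ n).mulVec 1 x) := by
  unfold expectedHittingTime
  simp_rw [toENNReal_hittingAfter]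
  rw [lintegral_tsum]
  · have := fun n => lintegral_avoid P hP v x n 1 (by intro; simp)
    simp only [Pi.one_apply, ENNReal.ofReal_one, mul_one] at this
    simp_rw [this]
    split_ifs <;> simp
  · intro n
    have h : Measurable (fun z : (∀ _ : Finset.Iic n, X) =>
      ∏ i, if z i = v then (0 : ℝ≥0∞) else 1) := measurable_of_finite _
    exact (h.comp (Preorder.measurable_frestrictLe (X := fun _ => X) n)).aemeasurable

end Classical

section Classical

variable {X : Type*} [Fintype X] [DecidableEq X]

lemma killed_pow_mulVec_mono {P : Matrix X X ℝ} (hP : P ∈ Matrix.rowStochastic ℝ X) (v : X)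
    (n : ℕ) {f g : X → ℝ} (hfg : f ≤ g) :
    ((killed P v) ^ n).mulVec f ≤ ((killed P v) ^ n).mulVec g := by
  have := killed_pow_mulVec_nonneg hP v n (sub_nonneg.2 hfg)
  rw [Matrix.mulVec_sub] at this
  exact sub_nonneg.1 this

lemma killed_pow_mulVec_le {P : Matrix X X ℝ} (hP : P ∈ Matrix.rowStochastic ℝ X) (v : X)
    (n : ℕ) {g : X → ℝ} (hg : 0 ≤ g) :
    ((killed P v) ^ n).mulVec g ≤ (P ^ n).mulVec g := by
  induction n with
  | zero => simp
  | succ n ih =>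
    rw [pow_succ', pow_succ', ← Matrix.mulVec_mulVec, ← Matrix.mulVec_mulVec]
    intro x
    refine Finset.sum_le_sum fun y _ => ?_
    have h0 := killed_pow_mulVec_nonneg hP v n hg y
    simp only [killed, Matrix.of_apply]
    split_ifs
    · rw [zero_mul]
      exact mul_nonneg (hP.1 x y) (h0.trans (ih y))
    · exact mul_le_mul_of_nonneg_left (ih y) (hP.1 x y)

lemma killed_mulVec_one {P : Matrix X X ℝ} (hP : P ∈ Matrix.rowStochastic ℝ X) (v : X) :
    (killed P v).mulVec 1 ≤ 1 := by
  intro x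
  rw [Pi.one_apply, ← Matrix.sum_row_of_mem_rowStochastic hP x]
  refine Finset.sum_le_sum fun y _ => ?_
  simp only [killed, Matrix.of_apply, Pi.one_apply, mul_one]
  split_ifs
  · exact hP.1 x y
  · exact le_rfl

lemma killed_pow_mulVec_one_le {P : Matrix X X ℝ} (hP : P ∈ Matrix.rowStochastic ℝ X) (v : X)
    (n : ℕ) : ((killed P v) ^ n).mulVec 1 ≤ 1 := by
  induction n with
  | zero => simp
  | succ n ih =>
    rw [pow_succ, ← Matrix.mulVec_mulVec]
    exact (killed_pow_mulVec_mono hP v n (killed_mulVec_one hP v)).trans ih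

/-- For a primitive chain, the probability to avoid `v` decreases by a fixed factor in a fixed
number of steps. -/
lemma exists_killed_pow_mulVec_one_le {P : Matrix X X ℝ} (hP : P ∈ Matrix.rowStochastic ℝ X)
    (hprim : P.IsPrimitive) (v : X) :
    ∃ m : ℕ, ∃ ρ : ℝ, 0 ≤ ρ ∧ ρ < 1 ∧ ((killed P v) ^ m).mulVec 1 ≤ ρ • (1 : X → ℝ) := by
  obtain ⟨m, hm, hpos⟩ := hprim.exists_pos_pow
  obtain ⟨m, rfl⟩ : ∃ l, m = l + 1 := ⟨m - 1, by omega⟩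
  have : Nonempty X := ⟨v⟩
  obtain ⟨x₀, hx₀⟩ := Finite.exists_min (fun x => (P ^ (m + 1)) x v)
  have hst := pow_mem hP (m + 1)
  refine ⟨m + 1, 1 - (P ^ (m + 1)) x₀ v, ?_, by linarith [hpos x₀ v], ?_⟩
  · exact sub_nonneg.2 (Matrix.le_one_of_mem_rowStochastic hst)
  · have h1 : (killed P v).mulVec 1 = P.mulVec (1 - Pi.single v 1) := by
      funext x
      refine Finset.sum_congr rfl fun y _ => ?_
      by_cases h : y = v
      · simp [killed, h]
      · simp [killed, h]
    have hPe : (0 : X → ℝ) ≤ 1 - Pi.single v 1 := by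
      intro y
      by_cases h : y = v
      · simp [h]
      · simp [h]
    have h2 : (killed P v).mulVec 1 = (killed P v).mulVec (1 - Pi.single v 1) := by
      funext x
      refine Finset.sum_congr rfl fun y _ => ?_
      by_cases h : y = v
      · simp [killed, h]
      · simp [h]
    rw [pow_succ, ← Matrix.mulVec_mulVec, h2, Matrix.mulVec_mulVec, ← pow_succ]
    refine (killed_pow_mulVec_le hP v (m + 1) hPe).trans ?_
    rw [Matrix.mulVec_sub, hst.2]
    intro x
    have := hx₀ x
    simp only [Matrix.mulVec_single_one, Pi.sub_apply, Pi.one_apply, Matrix.col_apply,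
      Pi.smul_apply, smul_eq_mul, mul_one]
    linarith

/-- The expected time to meet `v` is finite. -/
lemma summable_killed_pow {P : Matrix X X ℝ} (hP : P ∈ Matrix.rowStochastic ℝ X)
    (hprim : P.IsPrimitive) (v x : X) :
    Summable fun n : ℕ => ((killed P v) ^ n).mulVec 1 x := by
  obtain ⟨m, ρ, hρ0, hρ1, hρ⟩ := exists_killed_pow_mulVec_one_le hP hprim v
  have hnn : ∀ n, 0 ≤ ((killed P v) ^ n).mulVec 1 x := fun n =>
    killed_pow_mulVec_nonneg hP v n zero_le_one x
  -- the partial sums satisfy `S N ≤ S (m + N) ≤ m + ρ * S N`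
  refine summable_of_sum_range_le (c := m / (1 - ρ)) hnn fun N => ?_
  have hstep : ∀ n, ((killed P v) ^ (m + n)).mulVec 1 x ≤ ρ * ((killed P v) ^ n).mulVec 1 x := by
    intro n
    have := killed_pow_mulVec_mono hP v n hρ x
    rwa [Matrix.mulVec_mulVec, ← pow_add, Matrix.mulVec_smul, add_comm] at this
  have h1 : ∑ n ∈ Finset.range N, ((killed P v) ^ n).mulVec 1 x ≤
      ∑ n ∈ Finset.range (m + N), ((killed P v) ^ n).mulVec 1 x :=
    Finset.sum_le_sum_of_subset_of_nonneg (Finset.range_mono (by omega)) fun n _ _ => hnn n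
  have h2 : ∑ n ∈ Finset.range (m + N), ((killed P v) ^ n).mulVec 1 x ≤
      m + ρ * ∑ n ∈ Finset.range N, ((killed P v) ^ n).mulVec 1 x := by
    rw [Finset.sum_range_add, Finset.mul_sum]
    refine add_le_add ?_ (Finset.sum_le_sum fun n _ => hstep n)
    calc _ ≤ ∑ n ∈ Finset.range m, (1 : ℝ) :=
          Finset.sum_le_sum fun n _ => killed_pow_mulVec_one_le hP v n x
      _ = m := by simp
  rw [le_div_iff₀ (by linarith)]
  linarith

/-- First-step analysis: the expected hitting times are finite, they solve the equation
`h = 1 + P h` off `v` with the boundary value `h v = 0`, and `HT(P, v)` is their maximum. -/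
lemma exists_hittingTime_potential [MeasurableSpace X] [DiscreteMeasurableSpace X]
    {P : Matrix X X ℝ} (hP : P ∈ Matrix.rowStochastic ℝ X)
    (hprim : P.IsPrimitive) (v : X) (hne : ∃ x, x ≠ v) :
    ∃ h : X → ℝ, h v = 0 ∧ (∀ x, 0 ≤ h x) ∧ (∀ x, x ≠ v → h x = 1 + ∑ y, P x y * h y) ∧
      hittingTime P hP v < ⊤ ∧ (∀ x, h x ≤ (hittingTime P hP v).toReal) ∧
      1 ≤ (hittingTime P hP v).toReal := by
  have hsum := summable_killed_pow hP hprim v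
  have hnn : ∀ n x, 0 ≤ ((killed P v) ^ n).mulVec 1 x := fun n x =>
    killed_pow_mulVec_nonneg hP v n zero_le_one x
  set G : X → ℝ := fun x => ∑' n : ℕ, ((killed P v) ^ n).mulVec 1 x with hG
  have hG0 : ∀ x, 0 ≤ G x := fun x => tsum_nonneg fun n => hnn n x
  have hGeq : ∀ x, G x = 1 + ∑ y, killed P v x y * G y := by
    intro x
    simp only [hG]
    rw [(hsum x).tsum_eq_zero_add]
    congr 1
    · simp
    · simp_rw [← tsum_mul_left]
      rw [← Summable.tsum_finsetSum fun y _ => (hsum y).mul_left _]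
      refine tsum_congr fun n => ?_
      rw [pow_succ', ← Matrix.mulVec_mulVec]
      rfl
  have hE : ∀ x, expectedHittingTime P hP v x = ENNReal.ofReal (if x = v then 0 else G x) := by
    intro x
    rw [expectedHittingTime_eq_tsum]
    split_ifs
    · simp
    · rw [ENNReal.ofReal_tsum_of_nonneg (fun n => hnn n x) (hsum x)]
  have hfin : hittingTime P hP v < ⊤ := by
    unfold hittingTime
    have : Nonempty X := ⟨v⟩
    obtain ⟨x₀, hx₀⟩ := Finite.exists_max (fun x => expectedHittingTime P hP v x)
    refine lt_of_le_of_lt (iSup_le hx₀) ?_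
    rw [hE]
    exact ENNReal.ofReal_lt_top
  have hle : ∀ x, (if x = v then 0 else G x) ≤ (hittingTime P hP v).toReal := by
    intro x
    rw [← ENNReal.ofReal_le_iff_le_toReal hfin.ne, ← hE]
    exact le_iSup (fun x => expectedHittingTime P hP v x) x
  refine ⟨fun x => if x = v then 0 else G x, by simp, ?_, ?_, hfin, hle, ?_⟩
  · intro x
    dsimp only
    split_ifs
    exacts [le_rfl, hG0 x]
  · intro x hx
    dsimp only
    rw [if_neg hx, hGeq]
    congr 1
    refine Finset.sum_congr rfl fun y _ => ?_
    by_cases h : y = v <;> simp [h, killed]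
  · obtain ⟨x, hx⟩ := hne
    refine le_trans ?_ (hle x)
    rw [if_neg hx, hGeq]
    refine le_add_of_nonneg_right (Finset.sum_nonneg fun y _ => mul_nonneg ?_ (hG0 y))
    simp only [killed, Matrix.of_apply]
    split_ifs
    exacts [le_rfl, hP.1 x y]

/-! ### The stationary distribution -/

/-- The stationary distribution of a primitive reversible chain has full support. -/
lemma stationary_pos {P : Matrix X X ℝ} (hP : P ∈ Matrix.rowStochastic ℝ X)
    (hprim : P.IsPrimitive) {π : X → ℝ} (hπ : π ∈ stdSimplex ℝ X)
    (hrev : ∀ x y, π x * P x y = π y * P y x) (x : X) : 0 < π x := by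
  obtain ⟨m, -, hpos⟩ := hprim.exists_pos_pow
  have hstat : ∀ n : ℕ, Matrix.vecMul π (P ^ n) = π := by
    intro n
    induction n with
    | zero => simp
    | succ n ih =>
      rw [pow_succ, ← Matrix.vecMul_vecMul, ih]
      funext y
      rw [Matrix.vecMul, dotProduct]
      simp_rw [hrev _ y]
      rw [← Finset.mul_sum, Matrix.sum_row_of_mem_rowStochastic hP, mul_one]
  rw [← hstat m]
  refine lt_of_le_of_ne (Finset.sum_nonneg fun y _ => mul_nonneg (hπ.1 y) (hpos y x).le) ?_
  intro h0
  have hz := (Finset.sum_eq_zero_iff_of_nonneg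
    (fun y _ => mul_nonneg (hπ.1 y) (hpos y x).le)).1 h0.symm
  have : ∑ y, π y = 0 := Finset.sum_eq_zero fun y hy =>
    (mul_eq_zero.1 (hz y hy)).resolve_right (hpos y x).ne'
  rw [hπ.2] at this
  exact one_ne_zero this

/-- A return time to `v` is at most one more than a hitting time, so `π v` is at least of the
order of `1 / HT`: average `h = 1 + P h` against the stationary distribution. -/
lemma one_sub_stationary_le {P : Matrix X X ℝ} (hP : P ∈ Matrix.rowStochastic ℝ X)
    {π : X → ℝ} (hπ : π ∈ stdSimplex ℝ X)
    (hrev : ∀ x y, π x * P x y = π y * P y x) {v : X} {h : X → ℝ} {M : ℝ} (hv : h v = 0)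
    (hstep : ∀ x, x ≠ v → h x = 1 + ∑ y, P x y * h y) (hM : ∀ x, h x ≤ M) :
    1 - π v ≤ π v * M := by
  have h1 : ∑ x, π x * ∑ y, P x y * h y = ∑ y, π y * h y := by
    simp_rw [Finset.mul_sum]
    rw [Finset.sum_comm]
    refine Finset.sum_congr rfl fun y _ => ?_
    simp_rw [← mul_assoc, hrev _ y, mul_assoc, mul_left_comm (π y), ← Finset.sum_mul]
    rw [Matrix.sum_row_of_mem_rowStochastic hP, one_mul]
  have h2 : ∑ x, π x * (h x - ∑ y, P x y * h y) = 0 := by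
    simp_rw [mul_sub]
    rw [Finset.sum_sub_distrib, h1, sub_self]
  rw [← Finset.add_sum_erase _ _ (Finset.mem_univ v)] at h2
  have h3 : ∑ x ∈ Finset.univ.erase v, π x * (h x - ∑ y, P x y * h y) = 1 - π v := by
    rw [← hπ.2, ← Finset.add_sum_erase _ π (Finset.mem_univ v), add_sub_cancel_left]
    refine Finset.sum_congr rfl fun x hx => ?_
    have := hstep x (Finset.ne_of_mem_erase hx)
    rw [this, add_sub_cancel_right, mul_one]
  have h4 : ∑ y, P v y * h y ≤ M := by
    calc _ ≤ ∑ y, P v y * M :=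
          Finset.sum_le_sum fun y _ => mul_le_mul_of_nonneg_left (hM y) (hP.1 v y)
      _ = M := by rw [← Finset.sum_mul, Matrix.sum_row_of_mem_rowStochastic hP, one_mul]
  rw [h3, hv] at h2
  nlinarith [hπ.1 v]

end Classical

section Spectral

variable {X : Type*} [Fintype X] [DecidableEq X]

/-! ### The discriminant matrix of a reversible chain -/

/-- The discriminant matrix `D x y = √(Q x y) √(Q y x)` of the chain `Q`. -/
def discriminant (Q : Matrix X X ℝ) : Matrix X X ℝ :=
  Matrix.of fun x y => √(Q x y) * √(Q y x)

/-- `Q` is a stochastic matrix that is reversible with respect to the positive probability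
vector `σ`. -/
structure IsReversible (Q : Matrix X X ℝ) (σ : X → ℝ) : Prop where
  stoch : Q ∈ Matrix.rowStochastic ℝ X
  pos : ∀ x, 0 < σ x
  sum_eq_one : ∑ x, σ x = 1
  detailed_balance : ∀ x y, σ x * Q x y = σ y * Q y x

variable {Q : Matrix X X ℝ} {σ : X → ℝ}

omit [Fintype X] [DecidableEq X] in
lemma discriminant_isHermitian : (discriminant Q).IsHermitian := by
  ext x y
  simp [discriminant, mul_comm]

lemma IsReversible.nonneg (hQ : IsReversible Q σ) (x y : X) : 0 ≤ Q x y := hQ.stoch.1 x y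

lemma IsReversible.row_sum (hQ : IsReversible Q σ) (x : X) : ∑ y, Q x y = 1 :=
  Matrix.sum_row_of_mem_rowStochastic hQ.stoch x

lemma IsReversible.sqrt_detailed_balance (hQ : IsReversible Q σ) (x y : X) :
    √(σ x) * √(Q x y) = √(σ y) * √(Q y x) := by
  rw [← Real.sqrt_mul (hQ.pos x).le, ← Real.sqrt_mul (hQ.pos y).le, hQ.detailed_balance]

/-- The discriminant is conjugate to `Q` by the square root of the stationary distribution. -/
lemma IsReversible.discriminant_mul_sqrt (hQ : IsReversible Q σ) (x y : X) :
    discriminant Q x y * √(σ y) = √(σ x) * Q x y := by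
  have h1 := hQ.sqrt_detailed_balance x y
  have h2 := Real.mul_self_sqrt (hQ.nonneg x y)
  simp only [discriminant, Matrix.of_apply]
  linear_combination (-√(Q x y)) * h1 + √(σ x) * h2

/-- The vector `|√σ⟩` is a fixed vector of the discriminant. -/
lemma IsReversible.discriminant_mulVec_sqrt (hQ : IsReversible Q σ) :
    (discriminant Q).mulVec (fun x => √(σ x)) = fun x => √(σ x) := by
  funext x
  simp only [Matrix.mulVec, dotProduct]
  simp_rw [hQ.discriminant_mul_sqrt]
  rw [← Finset.mul_sum, hQ.row_sum, mul_one]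

lemma IsReversible.sqrt_dotProduct_self (hQ : IsReversible Q σ) :
    (fun x => √(σ x)) ⬝ᵥ (fun x => √(σ x)) = 1 := by
  simp only [dotProduct]
  rw [← hQ.sum_eq_one]
  exact Finset.sum_congr rfl fun x _ => Real.mul_self_sqrt (hQ.pos x).le

lemma IsReversible.sum_sum_left (hQ : IsReversible Q σ) (f : X → ℝ) :
    ∑ x, ∑ y, σ x * Q x y * f x = ∑ x, σ x * f x := by
  refine Finset.sum_congr rfl fun x _ => ?_
  rw [← Finset.sum_mul, ← Finset.mul_sum, hQ.row_sum, mul_one]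

lemma IsReversible.sum_sum_swap (hQ : IsReversible Q σ) (F : X → X → ℝ) :
    ∑ x, ∑ y, σ x * Q x y * F x y = ∑ x, ∑ y, σ x * Q x y * F y x := by
  rw [Finset.sum_comm]
  exact Finset.sum_congr rfl fun x _ => Finset.sum_congr rfl fun y _ => by
    rw [hQ.detailed_balance]

/-- The quadratic form of `1 ± D` as a sum over the edges of the chain. -/
lemma IsReversible.sum_sum_add_sq (hQ : IsReversible Q σ) (f : X → ℝ) {c : ℝ} (hc : c ^ 2 = 1) :
    ∑ x, ∑ y, σ x * Q x y * (f x + c * f y) ^ 2 =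
      2 * (∑ x, σ x * f x ^ 2 + c * ∑ x, ∑ y, σ x * Q x y * (f x * f y)) := by
  have h1 : ∀ x y, σ x * Q x y * (f x + c * f y) ^ 2 =
      σ x * Q x y * f x ^ 2 + σ x * Q x y * f y ^ 2 + 2 * c * (σ x * Q x y * (f x * f y)) := by
    intro x y
    linear_combination (σ x * Q x y * f y ^ 2) * hc
  simp_rw [h1, Finset.sum_add_distrib]
  rw [hQ.sum_sum_left (fun x => f x ^ 2), hQ.sum_sum_swap (fun x y => f y ^ 2),
    hQ.sum_sum_left (fun x => f x ^ 2)]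
  simp_rw [← Finset.mul_sum]
  ring

lemma IsReversible.dotProduct_eq (hQ : IsReversible Q σ) (φ : X → ℝ) :
    φ ⬝ᵥ φ = ∑ x, σ x * (φ x / √(σ x)) ^ 2 := by
  refine Finset.sum_congr rfl fun x _ => ?_
  rw [div_pow, Real.sq_sqrt (hQ.pos x).le, mul_div_cancel₀ _ (hQ.pos x).ne', sq]

lemma IsReversible.dotProduct_discriminant_eq (hQ : IsReversible Q σ) (φ : X → ℝ) :
    φ ⬝ᵥ (discriminant Q).mulVec φ =
      ∑ x, ∑ y, σ x * Q x y * (φ x / √(σ x) * (φ y / √(σ y))) := by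
  simp only [Matrix.mulVec, dotProduct, Finset.mul_sum]
  refine Finset.sum_congr rfl fun x _ => Finset.sum_congr rfl fun y _ => ?_
  have hx := Real.sqrt_pos.2 (hQ.pos x)
  have hy := Real.sqrt_pos.2 (hQ.pos y)
  have h1 := hQ.discriminant_mul_sqrt x y
  have h2 := Real.mul_self_sqrt (hQ.pos x).le
  field_simp
  linear_combination (φ x * φ y * √(σ x)) * h1 + (φ x * φ y * Q x y) * h2

/-- The form `⟨φ, (1 + D) φ⟩` is at least the contribution of the loop at `v`. -/
lemma IsReversible.two_mul_loop_le (hQ : IsReversible Q σ) (φ : X → ℝ) (v : X) :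
    2 * Q v v * φ v ^ 2 ≤ φ ⬝ᵥ φ + φ ⬝ᵥ (discriminant Q).mulVec φ := by
  have h1 := hQ.sum_sum_add_sq (fun x => φ x / √(σ x)) (c := 1) (by norm_num)
  rw [hQ.dotProduct_eq, hQ.dotProduct_discriminant_eq]
  have hnn : ∀ x y, 0 ≤ σ x * Q x y * (φ x / √(σ x) + 1 * (φ y / √(σ y))) ^ 2 := fun x y =>
    mul_nonneg (mul_nonneg (hQ.pos x).le (hQ.nonneg x y)) (sq_nonneg _)
  have h2 : σ v * Q v v * (φ v / √(σ v) + 1 * (φ v / √(σ v))) ^ 2 ≤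
      ∑ x, ∑ y, σ x * Q x y * (φ x / √(σ x) + 1 * (φ y / √(σ y))) ^ 2 :=
    (Finset.single_le_sum (fun y _ => hnn v y) (Finset.mem_univ v)).trans
      (Finset.single_le_sum (f := fun x => ∑ y, σ x * Q x y *
        (φ x / √(σ x) + 1 * (φ y / √(σ y))) ^ 2)
        (fun x _ => Finset.sum_nonneg fun y _ => hnn x y) (Finset.mem_univ v))
  have h3 : σ v * Q v v * (φ v / √(σ v) + 1 * (φ v / √(σ v))) ^ 2 = 4 * (Q v v * φ v ^ 2) := by
    have hs := Real.sq_sqrt (hQ.pos v).le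
    have h0 := (hQ.pos v).ne'
    rw [one_mul, ← two_mul, mul_pow, div_pow, hs]
    field_simp
    ring
  linarith

lemma IsReversible.dotProduct_discriminant_le (hQ : IsReversible Q σ) (φ : X → ℝ) :
    φ ⬝ᵥ (discriminant Q).mulVec φ ≤ φ ⬝ᵥ φ := by
  have h1 := hQ.sum_sum_add_sq (fun x => φ x / √(σ x)) (c := -1) (by norm_num)
  rw [hQ.dotProduct_eq, hQ.dotProduct_discriminant_eq]
  have h2 : 0 ≤ ∑ x, ∑ y, σ x * Q x y * (φ x / √(σ x) + -1 * (φ y / √(σ y))) ^ 2 :=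
    Finset.sum_nonneg fun x _ => Finset.sum_nonneg fun y _ =>
      mul_nonneg (mul_nonneg (hQ.pos x).le (hQ.nonneg x y)) (sq_nonneg _)
  linarith

/-! ### The spectral gap from a superharmonic function -/

/-- Barta's inequality: a positive function `u` with `Q u ≤ (1 - κ) u` on the support of `g`
bounds the Dirichlet form of `g` from below by `κ ‖g‖²`. -/
lemma IsReversible.barta (hQ : IsReversible Q σ) {u g : X → ℝ} {κ : ℝ} (hu : ∀ x, 0 < u x)
    (hκ : ∀ x, g x ≠ 0 → ∑ y, Q x y * u y ≤ (1 - κ) * u x) :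
    κ * ∑ x, σ x * g x ^ 2 ≤
      ∑ x, σ x * g x ^ 2 - ∑ x, ∑ y, σ x * Q x y * (g x * g y) := by
  have h1 : ∑ x, ∑ y, σ x * Q x y * (g x * g y) ≤
      ∑ x, ∑ y, σ x * Q x y * ((g x ^ 2 * u y / u x + g y ^ 2 * u x / u y) / 2) := by
    refine Finset.sum_le_sum fun x _ => Finset.sum_le_sum fun y _ =>
      mul_le_mul_of_nonneg_left ?_ (mul_nonneg (hQ.pos x).le (hQ.nonneg x y))
    have hx := hu x
    have hy := hu y
    have : (g x ^ 2 * u y / u x + g y ^ 2 * u x / u y) / 2 - g x * g y =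
        (g x * u y - g y * u x) ^ 2 / (2 * u x * u y) := by
      field_simp
      ring
    have h0 : 0 ≤ (g x * u y - g y * u x) ^ 2 / (2 * u x * u y) := by positivity
    linarith
  have h2 : ∑ x, ∑ y, σ x * Q x y * ((g x ^ 2 * u y / u x + g y ^ 2 * u x / u y) / 2) =
      ∑ x, ∑ y, σ x * Q x y * (g x ^ 2 * u y / u x) := by
    have h3 := hQ.sum_sum_swap (fun x y => g y ^ 2 * u x / u y)
    have h4 : ∀ x y, σ x * Q x y * ((g x ^ 2 * u y / u x + g y ^ 2 * u x / u y) / 2) =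
        σ x * Q x y * (g x ^ 2 * u y / u x) / 2 + σ x * Q x y * (g y ^ 2 * u x / u y) / 2 := by
      intro x y
      ring
    simp_rw [h4, Finset.sum_add_distrib, ← Finset.sum_div]
    rw [h3]
    ring
  have h5 : ∑ x, ∑ y, σ x * Q x y * (g x ^ 2 * u y / u x) ≤ (1 - κ) * ∑ x, σ x * g x ^ 2 := by
    rw [Finset.mul_sum]
    refine Finset.sum_le_sum fun x _ => ?_
    by_cases hg : g x = 0
    · simp [hg]
    · have h6 : ∑ y, σ x * Q x y * (g x ^ 2 * u y / u x) =
          σ x * g x ^ 2 / u x * ∑ y, Q x y * u y := by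
        rw [Finset.mul_sum]
        exact Finset.sum_congr rfl fun y _ => by ring
      have hx := hu x
      have hσ := hQ.pos x
      calc _ = σ x * g x ^ 2 / u x * ∑ y, Q x y * u y := h6
        _ ≤ σ x * g x ^ 2 / u x * ((1 - κ) * u x) :=
          mul_le_mul_of_nonneg_left (hκ x hg) (by positivity)
        _ = _ := by field_simp
  linarith

/-- A positive function `u` with `Q u ≤ (1 - κ) u` off `v` forces `⟨φ, (1 - D) φ⟩ ≥ κ ‖φ‖²` for
all `φ` orthogonal to `|√σ⟩`. -/
lemma IsReversible.gap (hQ : IsReversible Q σ) {u : X → ℝ} {κ : ℝ} {v : X}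
    (hκ0 : 0 ≤ κ) (hu : ∀ x, 0 < u x)
    (hκ : ∀ x, x ≠ v → ∑ y, Q x y * u y ≤ (1 - κ) * u x) {φ : X → ℝ}
    (hφ : φ ⬝ᵥ (fun x => √(σ x)) = 0) :
    κ * (φ ⬝ᵥ φ) ≤ φ ⬝ᵥ φ - φ ⬝ᵥ (discriminant Q).mulVec φ := by
  rw [hQ.dotProduct_eq, hQ.dotProduct_discriminant_eq]
  set f : X → ℝ := fun x => φ x / √(σ x) with hf
  have hmean : ∑ x, σ x * f x = 0 := by
    rw [← hφ]
    refine Finset.sum_congr rfl fun x _ => ?_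
    have hx := Real.sqrt_pos.2 (hQ.pos x)
    have h2 := Real.mul_self_sqrt (hQ.pos x).le
    simp only [hf]
    field_simp
    linear_combination (-φ x) * h2
  -- the shift `f - f v` vanishes at `v`, has the same Dirichlet form as `f`, and a norm that is not
  -- smaller because `f` has mean zero
  have hb := hQ.barta (g := fun x => f x - f v) hu
    (fun x hx => hκ x fun h => hx (by simp [h]))
  have h1 := hQ.sum_sum_add_sq f (c := -1) (by norm_num)
  have h2 := hQ.sum_sum_add_sq (fun x => f x - f v) (c := -1) (by norm_num)
  have h3 : ∑ x, σ x * (f x - f v) ^ 2 = ∑ x, σ x * f x ^ 2 + f v ^ 2 := by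
    have : ∀ x, σ x * (f x - f v) ^ 2 =
        σ x * f x ^ 2 - 2 * f v * (σ x * f x) + f v ^ 2 * σ x := fun x => by ring
    simp_rw [this, Finset.sum_add_distrib, Finset.sum_sub_distrib, ← Finset.mul_sum]
    rw [hmean, hQ.sum_eq_one]
    ring
  have h4 : ∑ x, ∑ y, σ x * Q x y * ((f x - f v) + -1 * (f y - f v)) ^ 2 =
      ∑ x, ∑ y, σ x * Q x y * (f x + -1 * f y) ^ 2 :=
    Finset.sum_congr rfl fun x _ => Finset.sum_congr rfl fun y _ => by ring
  rw [h4] at h2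
  have h5 : 0 ≤ κ * f v ^ 2 := by positivity
  change κ * ∑ x, σ x * f x ^ 2 ≤ ∑ x, σ x * f x ^ 2 - ∑ x, ∑ y, σ x * Q x y * (f x * f y)
  rw [h3] at hb h2
  nlinarith

/-! ### Eigenbases -/

/-- `φ` is an orthonormal basis of eigenvectors of the symmetric matrix `D`, with eigenvalues
`lam`. -/
structure IsEigenbasis (D : Matrix X X ℝ) (φ : X → X → ℝ) (lam : X → ℝ) : Prop where
  eig : ∀ n, D.mulVec (φ n) = lam n • φ n
  orth : ∀ n m, φ n ⬝ᵥ φ m = if n = m then 1 else 0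
  expand : ∀ u : X → ℝ, u = ∑ n, (φ n ⬝ᵥ u) • φ n

lemma exists_isEigenbasis {D : Matrix X X ℝ} (hD : D.IsHermitian) :
    ∃ φ lam, IsEigenbasis D φ lam := by
  refine ⟨fun n => hD.eigenvectorBasis n, hD.eigenvalues, ?_, ?_, ?_⟩
  · intro n
    exact hD.mulVec_eigenvectorBasis n
  · intro n m
    have := orthonormal_iff_ite.1 hD.eigenvectorBasis.orthonormal n m
    rw [← this, EuclideanSpace.inner_eq_star_dotProduct]
    simp [dotProduct_comm]
  · intro u
    have := hD.eigenvectorBasis.sum_repr' (WithLp.toLp 2 u)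
    have h2 := congrArg (WithLp.ofLp) this
    simp only [WithLp.ofLp_sum, WithLp.ofLp_smul] at h2
    refine h2.symm.trans (Finset.sum_congr rfl fun n _ => ?_)
    rw [EuclideanSpace.inner_eq_star_dotProduct]
    simp [dotProduct_comm]

namespace IsEigenbasis

variable {φ : X → X → ℝ} {lam : X → ℝ}

lemma sum_sq {D : Matrix X X ℝ} (hb : IsEigenbasis D φ lam) (u : X → ℝ) :
    ∑ n, (φ n ⬝ᵥ u) ^ 2 = u ⬝ᵥ u := by
  conv_rhs => enter [1]; rw [hb.expand u]
  rw [sum_dotProduct]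
  refine Finset.sum_congr rfl fun n _ => ?_
  rw [smul_dotProduct, smul_eq_mul, sq]

lemma eigenvalue_le_one (hQ : IsReversible Q σ) (hb : IsEigenbasis (discriminant Q) φ lam)
    (n : X) : lam n ≤ 1 := by
  have := hQ.dotProduct_discriminant_le (φ n)
  rwa [hb.eig, dotProduct_smul, hb.orth, if_pos rfl, smul_eq_mul, mul_one] at this

lemma neg_one_le_eigenvalue (hQ : IsReversible Q σ)
    (hb : IsEigenbasis (discriminant Q) φ lam) (n : X) : -1 ≤ lam n := by
  have := hQ.two_mul_loop_le (φ n) n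
  rw [hb.eig, dotProduct_smul, hb.orth, if_pos rfl, smul_eq_mul, mul_one] at this
  have h2 : 0 ≤ 2 * Q n n * φ n n ^ 2 := by
    have := hQ.nonneg n n
    positivity
  linarith

/-- A heavy loop at `v` keeps the marked node away from the eigenvalues near `-1`. -/
lemma two_mul_loop_mul_sum_le (hQ : IsReversible Q σ)
    (hb : IsEigenbasis (discriminant Q) φ lam) (v : X) {δ : ℝ} (hδ : 0 ≤ δ) (E : Finset X)
    (hE : ∀ n ∈ E, lam n ≤ -1 + δ) : 2 * Q v v * ∑ n ∈ E, φ n v ^ 2 ≤ δ := by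
  set W := ∑ n ∈ E, φ n v ^ 2 with hW
  -- the projection of `|v⟩` to the span of the eigenvectors in `E`
  set ψ : X → ℝ := ∑ n ∈ E, φ n v • φ n with hψ
  have hcoef : ∀ n ∈ E, φ n ⬝ᵥ ψ = φ n v := by
    intro n hn
    rw [hψ, dotProduct_sum, Finset.sum_eq_single n]
    · rw [dotProduct_smul, hb.orth, if_pos rfl, smul_eq_mul, mul_one]
    · intro m _ hm
      rw [dotProduct_smul, hb.orth, if_neg hm.symm, smul_zero]
    · exact fun h => absurd hn h
  have h1 : ψ v = W := by
    simp [hψ, hW, sq, Finset.sum_apply]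
  have h2 : ψ ⬝ᵥ ψ = W := by
    conv_lhs => enter [1]; rw [hψ]
    rw [sum_dotProduct]
    refine Finset.sum_congr rfl fun n hn => ?_
    rw [smul_dotProduct, hcoef n hn, smul_eq_mul, sq]
  have h3 : ψ ⬝ᵥ (discriminant Q).mulVec ψ = ∑ n ∈ E, lam n * φ n v ^ 2 := by
    conv_lhs => enter [2, 2]; rw [hψ]
    rw [Matrix.mulVec_sum, dotProduct_sum]
    refine Finset.sum_congr rfl fun n hn => ?_
    rw [Matrix.mulVec_smul, hb.eig, dotProduct_smul, dotProduct_smul, dotProduct_comm,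
      hcoef n hn, smul_eq_mul, smul_eq_mul]
    ring
  have h4 : ∑ n ∈ E, lam n * φ n v ^ 2 ≤ (-1 + δ) * W := by
    rw [hW, Finset.mul_sum]
    exact Finset.sum_le_sum fun n hn => mul_le_mul_of_nonneg_right (hE n hn) (sq_nonneg _)
  have h5 := hQ.two_mul_loop_le ψ v
  rw [h1, h2, h3] at h5
  have h6 : (2 * Q v v * W) * W ≤ δ * W := by nlinarith
  have hW0 : 0 ≤ W := Finset.sum_nonneg fun n _ => sq_nonneg _
  rcases hW0.eq_or_lt with h0 | h0
  · rw [← h0, mul_zero]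
    exact hδ
  · exact le_of_mul_le_mul_right h6 h0

/-- If `z` is orthogonal to `|√σ⟩`, then every eigenvector that overlaps with `z` is orthogonal
to `|√σ⟩` and obeys the gap: the gap makes the eigenvalue `1` simple, so an eigenvector that is not
orthogonal to `|√σ⟩` is a multiple of it. -/
lemma of_overlap_ne_zero (hQ : IsReversible Q σ)
    (hb : IsEigenbasis (discriminant Q) φ lam) {u : X → ℝ} {κ : ℝ} {v : X}
    (hκ0 : 0 < κ) (hu : ∀ x, 0 < u x)
    (hκ : ∀ x, x ≠ v → ∑ y, Q x y * u y ≤ (1 - κ) * u x) {z : X → ℝ}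
    (hz : (fun x => √(σ x)) ⬝ᵥ z = 0) {n : X} (hn : φ n ⬝ᵥ z ≠ 0) :
    φ n ⬝ᵥ (fun x => √(σ x)) = 0 ∧ κ ≤ 1 - lam n := by
  set w : X → ℝ := fun x => √(σ x) with hw
  have horth : φ n ⬝ᵥ w = 0 := by
    by_contra hne
    -- symmetry of `D` forces the eigenvalue `1`, and then the gap forces `φ n = c |√σ⟩`
    have h1 : lam n = 1 := by
      have h2 : (discriminant Q).mulVec (φ n) ⬝ᵥ w = φ n ⬝ᵥ (discriminant Q).mulVec w := by
        rw [Matrix.dotProduct_mulVec, ← Matrix.mulVec_transpose]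
        congr 2
        exact (discriminant_isHermitian (Q := Q)).symm
      rw [hb.eig, hQ.discriminant_mulVec_sqrt, smul_dotProduct, smul_eq_mul] at h2
      exact mul_right_cancel₀ hne (by rw [h2, one_mul])
    set c := φ n ⬝ᵥ w
    have hww : w ⬝ᵥ w = 1 := hQ.sqrt_dotProduct_self
    have hψw : (φ n - c • w) ⬝ᵥ w = 0 := by
      rw [sub_dotProduct, smul_dotProduct, hww, smul_eq_mul, mul_one, sub_self]
    have hg := hQ.gap hκ0.le hu hκ hψw
    have hD : (discriminant Q).mulVec (φ n - c • w) = φ n - c • w := by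
      rw [Matrix.mulVec_sub, Matrix.mulVec_smul, hb.eig, h1, hQ.discriminant_mulVec_sqrt, one_smul]
    rw [hD, sub_self] at hg
    have h0 : (φ n - c • w) ⬝ᵥ (φ n - c • w) = 0 :=
      le_antisymm (nonpos_of_mul_nonpos_right hg hκ0)
        (Finset.sum_nonneg fun x _ => mul_self_nonneg _)
    have h3 : φ n = c • w := sub_eq_zero.1 (dotProduct_self_eq_zero.1 h0)
    exact hn (by rw [h3, smul_dotProduct, hz, smul_zero])
  refine ⟨horth, ?_⟩
  have hg := hQ.gap hκ0.le hu hκ horth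
  rwa [hb.eig, dotProduct_smul, hb.orth, if_pos rfl, smul_eq_mul, mul_one, mul_one] at hg

end IsEigenbasis

end Spectral

section Interpolated

variable {X : Type*} [Fintype X] [DecidableEq X]

/-! ### The interpolated chain at the critical parameter -/

/-- The stationary distribution of the interpolated chain at `s = 1 - π v / (1 - π v)`: the
marked node has weight `1/2`, the other nodes share the rest in proportion to `π`. -/
def criticalStationary (π : X → ℝ) (v : X) (x : X) : ℝ :=
  if x = v then 1 / 2 else π x / (2 * (1 - π v))

omit [Fintype X] in
lemma criticalStationary_self (π : X → ℝ) (v : X) : criticalStationary π v v = 1 / 2 :=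
  if_pos rfl

omit [Fintype X] in
lemma interpolated_of_ne (P : Matrix X X ℝ) {v x : X} (s : ℝ) (hx : x ≠ v) (y : X) :
    interpolated P v s x y = P x y := by
  simp only [interpolated, absorbing, Matrix.add_apply, Matrix.smul_apply, smul_eq_mul,
    Matrix.updateRow_ne hx]
  ring

omit [Fintype X] in
lemma interpolated_self (P : Matrix X X ℝ) (v : X) (s : ℝ) (y : X) :
    interpolated P v s v y = (1 - s) * P v y + s * (Pi.single v 1 : X → ℝ) y := by
  simp [interpolated, absorbing, Matrix.add_apply]

lemma isReversible_interpolated {P : Matrix X X ℝ} (hP : P ∈ Matrix.rowStochastic ℝ X)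
    {π : X → ℝ} (hπ : π ∈ stdSimplex ℝ X) (hpos : ∀ x, 0 < π x)
    (hrev : ∀ x y, π x * P x y = π y * P y x) {v : X} (hv : π v ≤ 1 / 2) {s : ℝ}
    (hs : s = 1 - π v / (1 - π v)) :
    IsReversible (interpolated P v s) (criticalStationary π v) := by
  have hv0 := hpos v
  have hc : 0 < 1 - π v := by linarith
  have hs0 : 0 ≤ s := by
    rw [hs, sub_nonneg, div_le_one hc]
    linarith
  have hs1 : 0 ≤ 1 - s := by
    rw [hs, sub_sub_cancel]
    positivity
  have hbal : ∀ x, x ≠ v → criticalStationary π v x * interpolated P v s x v =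
      criticalStationary π v v * interpolated P v s v x := by
    intro x hx
    rw [interpolated_of_ne P s hx, interpolated_self, Pi.single_eq_of_ne hx,
      criticalStationary_self, criticalStationary, if_neg hx, hs]
    have := hrev x v
    field_simp
    linear_combination this
  refine ⟨Matrix.mem_rowStochastic_iff_sum.2 ⟨fun x y => ?_, fun x => ?_⟩, fun x => ?_, ?_,
    fun x y => ?_⟩
  · by_cases hx : x = v
    · subst hx
      rw [interpolated_self]
      refine add_nonneg (mul_nonneg hs1 (hP.1 _ _)) (mul_nonneg hs0 ?_)
      by_cases hy : y = x
      · simp [hy]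
      · simp [hy]
    · rw [interpolated_of_ne P s hx]
      exact hP.1 x y
  · by_cases hx : x = v
    · subst hx
      simp_rw [interpolated_self]
      rw [Finset.sum_add_distrib, ← Finset.mul_sum, ← Finset.mul_sum,
        Matrix.sum_row_of_mem_rowStochastic hP]
      simp
    · simp_rw [interpolated_of_ne P s hx]
      exact Matrix.sum_row_of_mem_rowStochastic hP x
  · unfold criticalStationary
    split_ifs
    · norm_num
    · exact div_pos (hpos x) (by linarith)
  · rw [← Finset.add_sum_erase _ _ (Finset.mem_univ v), criticalStationary_self]
    have h1 : ∑ x ∈ Finset.univ.erase v, criticalStationary π v x =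
        (∑ x ∈ Finset.univ.erase v, π x) / (2 * (1 - π v)) := by
      rw [Finset.sum_div]
      exact Finset.sum_congr rfl fun x hx => if_neg (Finset.ne_of_mem_erase hx)
    have h2 : ∑ x ∈ Finset.univ.erase v, π x = 1 - π v := by
      rw [← hπ.2, ← Finset.add_sum_erase _ π (Finset.mem_univ v), add_sub_cancel_left]
    rw [h1, h2]
    field_simp
    norm_num
  · by_cases hx : x = v
    · by_cases hy : y = v
      · rw [hx, hy]
      · rw [hx, hbal y hy]
    · by_cases hy : y = v
      · rw [hy, hbal x hx]
      · rw [interpolated_of_ne P s hx, interpolated_of_ne P s hy, criticalStationary,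
          criticalStationary, if_neg hx, if_neg hy]
        have := hrev x y
        field_simp
        linear_combination this

end Interpolated

section Quantum

variable {X : Type*} [Fintype X] [DecidableEq X]

/-! ### The walk operator on the reference subspace -/

/-- The contraction `(I ⊗ ⟨r|) ξ` of the second register with the reference state. -/
def contract (r : X → ℂ) (ξ : X × X → ℂ) : X → ℂ := fun x => ∑ y, star (r y) * ξ (x, y)

omit [DecidableEq X] in
lemma contract_tensorKet {r : X → ℂ} (hr : ∑ y, ‖r y‖ ^ 2 = 1) (φ : X → ℂ) :
    contract r (tensorKet φ r) = φ := by
  funext x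
  have h1 : ∀ y, star (r y) * (φ x * r y) = φ x * ((‖r y‖ ^ 2 : ℝ) : ℂ) := by
    intro y
    have h2 := Complex.conj_mul' (r y)
    rw [mul_left_comm, Complex.star_def, h2, Complex.ofReal_pow]
  simp only [contract, tensorKet]
  simp_rw [h1]
  rw [← Finset.mul_sum, ← Complex.ofReal_sum, hr, Complex.ofReal_one, mul_one]

lemma refProj_mulVec (r : X → ℂ) (ξ : X × X → ℂ) :
    (refProj r).mulVec ξ = tensorKet (contract r ξ) r := by
  funext p
  simp only [Matrix.mulVec, dotProduct, refProj, Matrix.kroneckerMap_apply, Matrix.vecMulVec_apply,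
    tensorKet, contract, Fintype.sum_prod_type, Matrix.one_apply]
  rw [Finset.sum_eq_single p.1]
  · rw [Finset.sum_mul]
    refine Finset.sum_congr rfl fun y _ => ?_
    simp
    ring
  · intro x _ hx
    exact Finset.sum_eq_zero fun y _ => by simp [hx.symm]
  · simp

lemma contract_eq_dotProduct (r : X → ℂ) (ξ : X × X → ℂ) (x : X) :
    contract r ξ x = star (tensorKet (Pi.single x 1) r) ⬝ᵥ ξ := by
  simp only [contract, dotProduct, tensorKet, Fintype.sum_prod_type, Pi.star_apply]
  rw [Finset.sum_eq_single (a := x) (f := fun a => ∑ b, star ((Pi.single x 1 : X → ℂ) a * r b) *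
    ξ (a, b))]
  · simp
  · intro y _ hy
    exact Finset.sum_eq_zero fun z _ => by simp [hy]
  · simp

open Classical in
/-- The permutation of the basis states that underlies `edgeSwap`. -/
def edgeFlip (P : Matrix X X ℝ) (b : X × X) : X × X :=
  if 0 < P b.1 b.2 then (b.2, b.1) else b

omit [Fintype X] [DecidableEq X] in
lemma edgeFlip_edgeFlip {P : Matrix X X ℝ} (hsymm : ∀ x y, 0 < P x y → 0 < P y x) (b : X × X) :
    edgeFlip P (edgeFlip P b) = b := by
  unfold edgeFlip
  by_cases h : 0 < P b.1 b.2
  · simp [h, hsymm _ _ h]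
  · simp [h]

lemma edgeSwap_mulVec {P : Matrix X X ℝ} (hsymm : ∀ x y, 0 < P x y → 0 < P y x)
    (ξ : X × X → ℂ) (b : X × X) : (edgeSwap P).mulVec ξ b = ξ (edgeFlip P b) := by
  simp only [Matrix.mulVec, dotProduct, edgeSwap, Matrix.of_apply]
  rw [Finset.sum_eq_single (edgeFlip P b)]
  · rw [if_pos, one_mul]
    exact (edgeFlip_edgeFlip hsymm b).symm
  · intro c _ hc
    rw [if_neg, zero_mul]
    intro h
    apply hc
    rw [h]
    exact (edgeFlip_edgeFlip hsymm c).symm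
  · simp

lemma edgeSwap_mul_self {P : Matrix X X ℝ} (hsymm : ∀ x y, 0 < P x y → 0 < P y x) :
    edgeSwap P * edgeSwap P = 1 := by
  refine Matrix.ext_of_mulVec_single fun i => ?_
  funext b
  rw [← Matrix.mulVec_mulVec, edgeSwap_mulVec hsymm, edgeSwap_mulVec hsymm,
    edgeFlip_edgeFlip hsymm, Matrix.one_mulVec]

omit [Fintype X] in
lemma edgeSwap_conjTranspose {P : Matrix X X ℝ} (hsymm : ∀ x y, 0 < P x y → 0 < P y x) :
    (edgeSwap P).conjTranspose = edgeSwap P := by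
  ext a b
  have : (a = edgeFlip P b) ↔ (b = edgeFlip P a) :=
    ⟨fun h => by rw [h, edgeFlip_edgeFlip hsymm], fun h => by rw [h, edgeFlip_edgeFlip hsymm]⟩
  simp only [Matrix.conjTranspose_apply, edgeSwap, Matrix.of_apply]
  change star (if b = edgeFlip P a then (1 : ℂ) else 0) = if a = edgeFlip P b then 1 else 0
  simp_rw [this]
  split_ifs <;> simp

/-- The operator `V† S V`. -/
def walkOp (P : Matrix X X ℝ) (V : Matrix (X × X) (X × X) ℂ) : Matrix (X × X) (X × X) ℂ :=
  V.conjTranspose * edgeSwap P * V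

lemma walkOp_mul_self {P : Matrix X X ℝ} (hsymm : ∀ x y, 0 < P x y → 0 < P y x)
    {V : Matrix (X × X) (X × X) ℂ} (hV : V ∈ Matrix.unitaryGroup (X × X) ℂ) :
    walkOp P V * walkOp P V = 1 := by
  have h1 : V * V.conjTranspose = 1 := Matrix.mem_unitaryGroup_iff.1 hV
  have h2 : V.conjTranspose * V = 1 := Matrix.mem_unitaryGroup_iff'.1 hV
  calc walkOp P V * walkOp P V
      = V.conjTranspose * edgeSwap P * (V * V.conjTranspose) * edgeSwap P * V := by
        simp only [walkOp, Matrix.mul_assoc]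
    _ = V.conjTranspose * (edgeSwap P * edgeSwap P) * V := by
        rw [h1, Matrix.mul_one, Matrix.mul_assoc V.conjTranspose]
    _ = 1 := by rw [edgeSwap_mul_self hsymm, Matrix.mul_one, h2]

lemma walkOp_conjTranspose {P : Matrix X X ℝ} (hsymm : ∀ x y, 0 < P x y → 0 < P y x)
    (V : Matrix (X × X) (X × X) ℂ) : (walkOp P V).conjTranspose = walkOp P V := by
  simp [walkOp, Matrix.conjTranspose_mul, edgeSwap_conjTranspose hsymm, Matrix.mul_assoc]

omit [Fintype X] in
lemma refProj_conjTranspose (r : X → ℂ) : (refProj r).conjTranspose = refProj r := by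
  simp [refProj, Matrix.conjTranspose_kronecker, Matrix.conjTranspose_vecMulVec]

lemma IsWalkUnitary.mulVec_tensorKet {Q : Matrix X X ℝ} {r : X → ℂ}
    {V : Matrix (X × X) (X × X) ℂ} (hV : IsWalkUnitary Q r V) (φ : X → ℂ) (p : X × X) :
    V.mulVec (tensorKet φ r) p = φ p.1 * (√(Q p.1 p.2) : ℝ) := by
  have h1 : tensorKet φ r = ∑ x, φ x • tensorKet (Pi.single x 1) r := by
    funext q
    simp only [tensorKet, Finset.sum_apply, Pi.smul_apply, smul_eq_mul]
    rw [Finset.sum_eq_single q.1]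
    · simp
    · intro x _ hx
      simp [hx.symm]
    · simp
  rw [h1, Matrix.mulVec_sum]
  simp_rw [Matrix.mulVec_smul, hV.2]
  simp only [Finset.sum_apply, Pi.smul_apply, smul_eq_mul]
  rw [Finset.sum_eq_single p.1]
  · congr 1
    rw [Finset.sum_eq_single p.2]
    · simp
    · intro y _ hy
      rw [Pi.single_eq_of_ne, mul_zero]
      intro h
      exact hy (by rw [h])
    · simp
  · intro x _ hx
    rw [Finset.sum_eq_zero, mul_zero]
    intro y _
    rw [Pi.single_eq_of_ne, mul_zero]
    intro h
    exact hx (by rw [h])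
  · simp

variable {P Q : Matrix X X ℝ} {σ : X → ℝ} {r : X → ℂ} {V : Matrix (X × X) (X × X) ℂ}

omit [Fintype X] [DecidableEq X] in
/-- On the support of `Q` the edge swap acts as the full swap. -/
lemma edgeFlip_eq_swap (hedge : ∀ x y, Q x y ≠ 0 → 0 < P x y ∨ x = y) {x y : X}
    (h : Q x y ≠ 0) : edgeFlip P (x, y) = (y, x) := by
  unfold edgeFlip
  rcases hedge x y h with h1 | h1
  · exact if_pos h1
  · subst h1
    simp

/-- The compression of `V† S V` to the reference subspace is the discriminant. -/
lemma contract_walkOp_mulVec (hV : IsWalkUnitary Q r V)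
    (hsymm : ∀ x y, 0 < P x y → 0 < P y x)
    (hedge : ∀ x y, Q x y ≠ 0 → 0 < P x y ∨ x = y) (φ : X → ℝ) :
    contract r ((walkOp P V).mulVec (tensorKet (fun x => (φ x : ℂ)) r)) =
      fun x => (((discriminant Q).mulVec φ x : ℝ) : ℂ) := by
  funext x
  rw [contract_eq_dotProduct, walkOp, ← Matrix.mulVec_mulVec, ← Matrix.mulVec_mulVec,
    Matrix.dotProduct_mulVec, ← Matrix.star_mulVec, dotProduct, Fintype.sum_prod_type,
    Finset.sum_eq_single x]
  · simp only [Matrix.mulVec, dotProduct]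
    push_cast
    refine Finset.sum_congr rfl fun y _ => ?_
    change star (V.mulVec (tensorKet (Pi.single x 1) r) (x, y)) *
      (edgeSwap P).mulVec (V.mulVec (tensorKet (fun x => (φ x : ℂ)) r)) (x, y) = _
    rw [edgeSwap_mulVec hsymm, hV.mulVec_tensorKet, hV.mulVec_tensorKet]
    by_cases hq : Q x y = 0
    · simp [hq, discriminant]
    · rw [edgeFlip_eq_swap hedge hq]
      simp [discriminant]
      ring
  · intro y _ hy
    refine Finset.sum_eq_zero fun z _ => ?_
    rw [Pi.star_apply, hV.mulVec_tensorKet]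
    simp [hy]
  · simp

/-- The stationary state is fixed by `V† S V`: this is detailed balance. -/
lemma walkOp_mulVec_stationary (hV : IsWalkUnitary Q r V) (hQ : IsReversible Q σ)
    (hsymm : ∀ x y, 0 < P x y → 0 < P y x) :
    (walkOp P V).mulVec (tensorKet (fun x => ((√(σ x) : ℝ) : ℂ)) r) =
      tensorKet (fun x => ((√(σ x) : ℝ) : ℂ)) r := by
  set w := tensorKet (fun x => ((√(σ x) : ℝ) : ℂ)) r
  have h1 : (edgeSwap P).mulVec (V.mulVec w) = V.mulVec w := by
    funext p
    rw [edgeSwap_mulVec hsymm, hV.mulVec_tensorKet, hV.mulVec_tensorKet]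
    unfold edgeFlip
    split_ifs
    · rw [← Complex.ofReal_mul, ← Complex.ofReal_mul, hQ.sqrt_detailed_balance]
    · rfl
  rw [walkOp, ← Matrix.mulVec_mulVec, ← Matrix.mulVec_mulVec, h1, Matrix.mulVec_mulVec,
    show V.conjTranspose * V = 1 from Matrix.mem_unitaryGroup_iff'.1 hV.1, Matrix.one_mulVec]

/-! ### The evolution of the reference subspace -/

/-- The generator `B = [V† S V, Π₀]` of the search evolution `exp (-i H t) = exp (t B)`. -/
def generator (P : Matrix X X ℝ) (r : X → ℂ) (V : Matrix (X × X) (X × X) ℂ) :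
    Matrix (X × X) (X × X) ℂ :=
  walkOp P V * refProj r - refProj r * walkOp P V

lemma neg_smul_searchHamiltonian (P : Matrix X X ℝ) (r : X → ℂ)
    (V : Matrix (X × X) (X × X) ℂ) (t : ℝ) :
    -(Complex.I * (t : ℂ)) • searchHamiltonian P r V = (t : ℂ) • generator P r V := by
  rw [searchHamiltonian, smul_smul, Ring.lie_def]
  change _ • generator P r V = _
  congr 1
  linear_combination (-(t : ℂ)) * Complex.I_mul_I

lemma generator_conjTranspose (hsymm : ∀ x y, 0 < P x y → 0 < P y x) :
    (generator P r V).conjTranspose = -generator P r V := by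
  simp [generator, Matrix.conjTranspose_mul, walkOp_conjTranspose hsymm, refProj_conjTranspose]

lemma refProj_mulVec_tensorKet (hr : ∑ y, ‖r y‖ ^ 2 = 1) (φ : X → ℂ) :
    (refProj r).mulVec (tensorKet φ r) = tensorKet φ r := by
  rw [refProj_mulVec, contract_tensorKet hr]

lemma generator_mulVec_stationary (hr : ∑ y, ‖r y‖ ^ 2 = 1) (hV : IsWalkUnitary Q r V)
    (hQ : IsReversible Q σ) (hsymm : ∀ x y, 0 < P x y → 0 < P y x) :
    (generator P r V).mulVec (tensorKet (fun x => ((√(σ x) : ℝ) : ℂ)) r) = 0 := by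
  rw [generator, Matrix.sub_mulVec, ← Matrix.mulVec_mulVec, ← Matrix.mulVec_mulVec,
    walkOp_mulVec_stationary hV hQ hsymm, refProj_mulVec_tensorKet hr,
    walkOp_mulVec_stationary hV hQ hsymm, sub_self]

omit [Fintype X] [DecidableEq X] in
lemma tensorKet_smul (c : ℂ) (φ r : X → ℂ) : tensorKet (c • φ) r = c • tensorKet φ r := by
  funext p
  simp [tensorKet, mul_assoc]

omit [DecidableEq X] in
lemma contract_smul (c : ℂ) (r : X → ℂ) (ξ : X × X → ℂ) :
    contract r (c • ξ) = c • contract r ξ := by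
  funext x
  simp only [contract, Pi.smul_apply, smul_eq_mul, Finset.mul_sum]
  exact Finset.sum_congr rfl fun y _ => by ring

omit [DecidableEq X] in
lemma contract_sub (r : X → ℂ) (ξ η : X × X → ℂ) :
    contract r (ξ - η) = contract r ξ - contract r η := by
  funext x
  simp [contract, mul_sub]

/-- On an eigenvector `φ` of the discriminant, `B` leaves the reference subspace and `B²` acts as
the scalar `-(1 - λ²)`. -/
lemma generator_mulVec_eigen (hr : ∑ y, ‖r y‖ ^ 2 = 1) (hV : IsWalkUnitary Q r V)
    (hsymm : ∀ x y, 0 < P x y → 0 < P y x)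
    (hedge : ∀ x y, Q x y ≠ 0 → 0 < P x y ∨ x = y) {φ : X → ℝ} {l : ℝ}
    (hφ : (discriminant Q).mulVec φ = l • φ) :
    contract r ((generator P r V).mulVec (tensorKet (fun x => (φ x : ℂ)) r)) = 0 ∧
    (generator P r V).mulVec ((generator P r V).mulVec (tensorKet (fun x => (φ x : ℂ)) r)) =
      (-(1 - l ^ 2 : ℝ) : ℂ) • tensorKet (fun x => (φ x : ℂ)) r := by
  set ψ := tensorKet (fun x => (φ x : ℂ)) r with hψ
  have hR : (refProj r).mulVec ψ = ψ := refProj_mulVec_tensorKet hr _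
  have hc : contract r ((walkOp P V).mulVec ψ) = (l : ℂ) • fun x => (φ x : ℂ) := by
    rw [contract_walkOp_mulVec hV hsymm hedge, hφ]
    funext x
    simp
  have hRA : (refProj r).mulVec ((walkOp P V).mulVec ψ) = (l : ℂ) • ψ := by
    rw [refProj_mulVec, hc, tensorKet_smul]
  have hAA : (walkOp P V).mulVec ((walkOp P V).mulVec ψ) = ψ := by
    rw [Matrix.mulVec_mulVec, walkOp_mul_self hsymm hV.1, Matrix.one_mulVec]
  have hB : (generator P r V).mulVec ψ = (walkOp P V).mulVec ψ - (l : ℂ) • ψ := by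
    rw [generator, Matrix.sub_mulVec, ← Matrix.mulVec_mulVec, ← Matrix.mulVec_mulVec, hR, hRA]
  have hBA : (generator P r V).mulVec ((walkOp P V).mulVec ψ) =
      (l : ℂ) • (walkOp P V).mulVec ψ - ψ := by
    rw [generator, Matrix.sub_mulVec, ← Matrix.mulVec_mulVec, ← Matrix.mulVec_mulVec, hRA, hAA,
      hR, Matrix.mulVec_smul]
  constructor
  · rw [hB, contract_sub, hc, contract_smul, hψ, contract_tensorKet hr, sub_self]
  · rw [hB, Matrix.mulVec_sub, hBA, Matrix.mulVec_smul, hB, smul_sub, smul_smul]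
    push_cast
    rw [show (-(1 - (l : ℂ) ^ 2)) • ψ = (l * l : ℂ) • ψ - ψ by
      rw [neg_sub, sub_smul, one_smul, sq]]
    abel

end Quantum

/-! ### The exponential of the generator -/

section Exponential

open scoped Nat

variable {m : Type*} [Fintype m] [DecidableEq m]

attribute [local instance] Matrix.linftyOpNormedRing Matrix.linftyOpNormedAlgebra in
lemma hasSum_exp_mulVec (M : Matrix m m ℂ) (ψ : m → ℂ) :
    HasSum (fun n : ℕ => ((n ! : ℂ)⁻¹) • (M ^ n).mulVec ψ) ((NormedSpace.exp M).mulVec ψ) := by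
  have h := NormedSpace.exp_series_hasSum_exp' (𝕂 := ℂ) M
  have h2 := h.map ((Matrix.mulVecBilin ℂ ℂ).flip ψ)
    (show Continuous fun A : Matrix m m ℂ => A.mulVec ψ from
      continuous_id.matrix_mulVec continuous_const)
  convert h2 using 1
  · funext n
    simp
  · rfl

attribute [local instance] Matrix.linftyOpNormedRing Matrix.linftyOpNormedAlgebra in
lemma continuous_exp_smul (M : Matrix m m ℂ) :
    Continuous fun t : ℝ => NormedSpace.exp ((t : ℂ) • M) := by
  have h := NormedSpace.exp_continuous (𝔸 := Matrix m m ℂ)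
  exact h.comp (Complex.continuous_ofReal.smul continuous_const)

lemma exp_smul_mulVec_of_mulVec_eq_zero {M : Matrix m m ℂ} {ψ : m → ℂ} (h : M.mulVec ψ = 0)
    (c : ℂ) : (NormedSpace.exp (c • M)).mulVec ψ = ψ := by
  refine (hasSum_exp_mulVec (c • M) ψ).unique ?_
  convert! hasSum_ite_eq 0 ψ using 2 with n
  cases n with
  | zero => simp
  | succ n => simp [pow_succ, ← Matrix.mulVec_mulVec, Matrix.smul_mulVec, h]

lemma exp_mem_unitaryGroup {B : Matrix m m ℂ} (hB : B.conjTranspose = -B) (t : ℝ) :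
    NormedSpace.exp ((t : ℂ) • B) ∈ Matrix.unitaryGroup m ℂ := by
  rw [Matrix.mem_unitaryGroup_iff, Matrix.star_eq_conjTranspose, ← Matrix.exp_conjTranspose,
    Matrix.conjTranspose_smul, hB, ← Matrix.exp_add_of_commute]
  · simp
  · simp [Commute, SemiconjBy]

variable {X : Type*} [Fintype X] [DecidableEq X]

omit [DecidableEq X] in
lemma hasSum_contract {r : X → ℂ} {f : ℕ → X × X → ℂ} {ξ : X × X → ℂ} (h : HasSum f ξ) (x : X) :
    HasSum (fun n => contract r (f n) x) (contract r ξ x) :=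
  hasSum_sum fun y _ => ((Pi.hasSum.1 h) (x, y)).mul_left _

/-- If `B` maps `ψ` out of the reference subspace and `B² ψ = -θ² ψ`, then the component of
`exp (t B) ψ` in the reference subspace oscillates as `cos (θ t)`. -/
lemma contract_exp_mulVec {r : X → ℂ} {B : Matrix (X × X) (X × X) ℂ} {ψ : X × X → ℂ} {θ : ℝ}
    (h1 : contract r (B.mulVec ψ) = 0)
    (h2 : B.mulVec (B.mulVec ψ) = (-(θ ^ 2 : ℝ) : ℂ) • ψ) (t : ℝ) (x : X) :
    contract r ((NormedSpace.exp ((t : ℂ) • B)).mulVec ψ) x =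
      (Real.cos (θ * t) : ℂ) * contract r ψ x := by
  have hs := hasSum_contract (r := r) (hasSum_exp_mulVec ((t : ℂ) • B) ψ) x
  have hsq : B ^ 2 = B * B := sq B
  have heven : ∀ k : ℕ, (B ^ (2 * k)).mulVec ψ = ((-(θ ^ 2 : ℝ) : ℂ)) ^ k • ψ := by
    intro k
    induction k with
    | zero => simp
    | succ k ih =>
      rw [mul_add, mul_one, pow_add, ← Matrix.mulVec_mulVec, hsq, ← Matrix.mulVec_mulVec, h2,
        Matrix.mulVec_smul, ih, smul_smul, ← pow_succ']
  have hodd : ∀ k : ℕ, (B ^ (2 * k + 1)).mulVec ψ = ((-(θ ^ 2 : ℝ) : ℂ)) ^ k • B.mulVec ψ := by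
    intro k
    rw [pow_succ', ← Matrix.mulVec_mulVec, heven, Matrix.mulVec_smul]
  refine hs.unique ?_
  rw [← add_zero ((Real.cos (θ * t) : ℂ) * contract r ψ x)]
  refine HasSum.even_add_odd ?_ ?_
  · have hcos := (Complex.hasSum_cos ((θ * t : ℝ) : ℂ)).mul_right (contract r ψ x)
    rw [← Complex.ofReal_cos] at hcos
    convert! hcos using 1
    funext k
    rw [smul_pow, Matrix.smul_mulVec, heven, contract_smul, contract_smul, contract_smul]
    simp only [Pi.smul_apply, smul_eq_mul]
    push_cast
    rw [neg_pow ((θ : ℂ) ^ 2) k, ← pow_mul, mul_pow]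
    ring
  · convert! hasSum_zero using 1
    funext k
    rw [smul_pow, Matrix.smul_mulVec, hodd, contract_smul, contract_smul, contract_smul, h1]
    simp

end Exponential

/-! ### The success probability at a fixed time -/

section Success

variable {X : Type*} [Fintype X] [DecidableEq X]
variable {P Q : Matrix X X ℝ} {σ : X → ℝ} {r : X → ℂ} {V : Matrix (X × X) (X × X) ℂ}

omit [DecidableEq X] in
lemma contract_sum {ι : Type*} (s : Finset ι) (r : X → ℂ) (f : ι → X × X → ℂ) :
    contract r (∑ i ∈ s, f i) = ∑ i ∈ s, contract r (f i) := by
  funext x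
  simp only [contract, Finset.sum_apply, Finset.mul_sum]
  rw [Finset.sum_comm]

/-- The reference component of the evolution of an arbitrary state `z ⊗ r`, in an eigenbasis of
the discriminant. -/
lemma contract_exp_generator (hr : ∑ y, ‖r y‖ ^ 2 = 1) (hV : IsWalkUnitary Q r V)
    (hQ : IsReversible Q σ) (hsymm : ∀ x y, 0 < P x y → 0 < P y x)
    (hedge : ∀ x y, Q x y ≠ 0 → 0 < P x y ∨ x = y) {φ : X → X → ℝ} {lam : X → ℝ}
    (hb : IsEigenbasis (discriminant Q) φ lam) (z : X → ℝ) (t : ℝ) (x : X) :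
    contract r ((NormedSpace.exp ((t : ℂ) • generator P r V)).mulVec
      (tensorKet (fun x => (z x : ℂ)) r)) x =
      ((∑ n, (φ n ⬝ᵥ z) * Real.cos (√(1 - lam n ^ 2) * t) * φ n x : ℝ) : ℂ) := by
  have hz : tensorKet (fun x => (z x : ℂ)) r =
      ∑ n, ((φ n ⬝ᵥ z : ℝ) : ℂ) • tensorKet (fun x => (φ n x : ℂ)) r := by
    funext p
    have h := congrFun (hb.expand z) p.1
    simp only [tensorKet, Finset.sum_apply, Pi.smul_apply, smul_eq_mul] at h ⊢
    conv_lhs => rw [h]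
    push_cast
    rw [Finset.sum_mul]
    exact Finset.sum_congr rfl fun n _ => by ring
  rw [hz, Matrix.mulVec_sum, contract_sum, Finset.sum_apply]
  push_cast
  refine Finset.sum_congr rfl fun n _ => ?_
  have h0 : 0 ≤ 1 - lam n ^ 2 := by
    nlinarith [hb.eigenvalue_le_one hQ n, hb.neg_one_le_eigenvalue hQ n]
  obtain ⟨h1, h2⟩ := generator_mulVec_eigen hr hV hsymm hedge (hb.eig n)
  have h3 := contract_exp_mulVec (θ := √(1 - lam n ^ 2)) h1
    (by rw [h2, Real.sq_sqrt h0]) t x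
  rw [Matrix.mulVec_smul, contract_smul, Pi.smul_apply, h3, contract_tensorKet hr]
  simp [mul_assoc]

/-- The part of the initial state along the stationary state does not move; the interference of
this part with the rest bounds the success probability from below. -/
lemma le_successProb (hr : ∑ y, ‖r y‖ ^ 2 = 1) (hV : IsWalkUnitary Q r V)
    (hQ : IsReversible Q σ) (hsymm : ∀ x y, 0 < P x y → 0 < P y x)
    (hedge : ∀ x y, Q x y ≠ 0 → 0 < P x y ∨ x = y) {φ : X → X → ℝ} {lam : X → ℝ}
    (hb : IsEigenbasis (discriminant Q) φ lam) (a b : ℝ) (z : X → ℝ) (v : X) (t : ℝ) :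
    a ^ 2 * σ v + 2 * a * b * √(σ v) *
      ∑ n, (φ n ⬝ᵥ z) * Real.cos (√(1 - lam n ^ 2) * t) * φ n v ≤
    successProb (searchHamiltonian P r V)
      (tensorKet (fun x => ((a * √(σ x) + b * z x : ℝ) : ℂ)) r) v t := by
  have hsplit : tensorKet (fun x => ((a * √(σ x) + b * z x : ℝ) : ℂ)) r =
      (a : ℂ) • tensorKet (fun x => ((√(σ x) : ℝ) : ℂ)) r +
        (b : ℂ) • tensorKet (fun x => (z x : ℂ)) r := by
    funext p
    simp [tensorKet]
    ring
  have hc := contract_exp_generator hr hV hQ hsymm hedge hb z t v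
  unfold successProb
  rw [neg_smul_searchHamiltonian, hsplit, Matrix.mulVec_add, Matrix.mulVec_smul,
    Matrix.mulVec_smul,
    exp_smul_mulVec_of_mulVec_eq_zero (generator_mulVec_stationary hr hV hQ hsymm)]
  set ζ := (NormedSpace.exp ((t : ℂ) • generator P r V)).mulVec
    (tensorKet (fun x => (z x : ℂ)) r) with hζ
  set c := ∑ n, (φ n ⬝ᵥ z) * Real.cos (√(1 - lam n ^ 2) * t) * φ n v with hcdef
  -- expand the square and drop the contribution of `b ζ` alone
  have hpt : ∀ y, a ^ 2 * σ v * ‖r y‖ ^ 2 + 2 * a * b * √(σ v) * (star (r y) * ζ (v, y)).re ≤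
      ‖((a : ℂ) • tensorKet (fun x => ((√(σ x) : ℝ) : ℂ)) r + (b : ℂ) • ζ) (v, y)‖ ^ 2 := by
    intro y
    have hs := Real.sq_sqrt (hQ.pos v).le
    simp only [Pi.add_apply, Pi.smul_apply, tensorKet, smul_eq_mul]
    rw [← Complex.normSq_eq_norm_sq, ← Complex.normSq_eq_norm_sq, Complex.normSq_apply,
      Complex.normSq_apply]
    simp only [Complex.add_re, Complex.add_im, Complex.mul_re, Complex.mul_im, Complex.ofReal_re,
      Complex.ofReal_im, Complex.star_def, Complex.conj_re, Complex.conj_im]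
    generalize √(σ v) = q at hs ⊢
    rw [← hs]
    nlinarith [sq_nonneg (b * (ζ (v, y)).re), sq_nonneg (b * (ζ (v, y)).im)]
  refine le_trans (le_of_eq ?_) (Finset.sum_le_sum fun y _ => hpt y)
  rw [Finset.sum_add_distrib, ← Finset.mul_sum, ← Finset.mul_sum, hr, mul_one, ← Complex.re_sum]
  change _ = _ + _ * (contract r ζ v).re
  rw [hc, Complex.ofReal_re]

lemma continuous_successProb (P : Matrix X X ℝ) (r : X → ℂ) (V : Matrix (X × X) (X × X) ℂ)
    (ψ : X × X → ℂ) (v : X) :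
    Continuous (successProb (searchHamiltonian P r V) ψ v) := by
  unfold successProb
  simp_rw [neg_smul_searchHamiltonian]
  refine continuous_finsetSum _ fun y _ => ?_
  have h : Continuous fun t : ℝ =>
      (NormedSpace.exp ((t : ℂ) • generator P r V)).mulVec ψ :=
    (continuous_exp_smul _).matrix_mulVec continuous_const
  exact ((continuous_apply (v, y)).comp h).norm.pow 2

lemma exists_successProb_le (hsymm : ∀ x y, 0 < P x y → 0 < P y x)
    (ψ : X × X → ℂ) (v : X) :
    ∃ K, ∀ t, ‖successProb (searchHamiltonian P r V) ψ v t‖ ≤ K := by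
  refine ⟨∑ y : X, (∑ q, ‖ψ q‖) ^ 2, fun t => ?_⟩
  unfold successProb
  rw [neg_smul_searchHamiltonian, Real.norm_of_nonneg (Finset.sum_nonneg fun y _ => sq_nonneg _)]
  have hU := exp_mem_unitaryGroup (generator_conjTranspose (r := r) (V := V) hsymm) t
  refine Finset.sum_le_sum fun y _ => pow_le_pow_left₀ (norm_nonneg _) ?_ 2
  refine (norm_sum_le _ _).trans (Finset.sum_le_sum fun q _ => ?_)
  rw [norm_mul]
  exact mul_le_of_le_one_left (norm_nonneg _) (entry_norm_bound_of_unitary hU _ _)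

end Success

/-! ### Averages over the random evolution time -/

section Average

/-- The characteristic function of the uniform distribution on `[0, T]`. -/
def uniformChar (T θ : ℝ) : ℂ :=
  ∫ t, Complex.exp ((θ * t : ℝ) * Complex.I) ∂(ProbabilityTheory.cond volume (Set.Icc 0 T))

lemma isProbabilityMeasure_cond_Icc {T : ℝ} (hT : 0 < T) :
    IsProbabilityMeasure (ProbabilityTheory.cond volume (Set.Icc 0 T)) :=
  cond_isProbabilityMeasure_of_finite (by simp [hT]) (by simp)

lemma norm_uniformChar_le_one {T : ℝ} (hT : 0 < T) (θ : ℝ) : ‖uniformChar T θ‖ ≤ 1 := by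
  have := isProbabilityMeasure_cond_Icc hT
  have h := norm_integral_le_of_norm_le_const (μ := ProbabilityTheory.cond volume (Set.Icc 0 T))
    (f := fun t : ℝ => Complex.exp ((θ * t : ℝ) * Complex.I)) (C := 1)
    (Filter.Eventually.of_forall fun t => by rw [Complex.norm_exp_ofReal_mul_I])
  simpa [uniformChar] using h

lemma norm_uniformChar_le {T θ : ℝ} (hT : 0 < T) (hθ : 0 < θ) :
    ‖uniformChar T θ‖ ≤ 2 / (θ * T) := by
  have h1 : uniformChar T θ = (T⁻¹ : ℝ) • ∫ t in (0 : ℝ)..T, Complex.exp ((θ * Complex.I) * t) := by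
    rw [uniformChar, ProbabilityTheory.cond, integral_smul_measure,
      intervalIntegral.integral_of_le hT.le, integral_Icc_eq_integral_Ioc]
    congr 1
    · simp [hT.le]
    · refine integral_congr_ae (Filter.Eventually.of_forall fun t => ?_)
      simp only
      congr 1
      push_cast
      ring
  have hne : (θ : ℂ) * Complex.I ≠ 0 :=
    mul_ne_zero (Complex.ofReal_ne_zero.2 hθ.ne') Complex.I_ne_zero
  have h2 : ‖Complex.exp (θ * Complex.I * (T : ℝ)) - Complex.exp (θ * Complex.I * (0 : ℝ))‖ ≤ 2 := by
    refine (norm_sub_le _ _).trans ?_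
    have h3 : (θ : ℂ) * Complex.I * (T : ℝ) = ((θ * T : ℝ) : ℂ) * Complex.I := by
      push_cast
      ring
    rw [h3, Complex.norm_exp_ofReal_mul_I]
    norm_num
  rw [h1, integral_exp_mul_complex hne, norm_smul, norm_div, norm_mul, Complex.norm_I, mul_one,
    Complex.norm_real, Real.norm_of_nonneg hθ.le, Real.norm_of_nonneg (by positivity)]
  calc _ ≤ T⁻¹ * (2 / θ) := by gcongr
    _ = 2 / (θ * T) := by field_simp

lemma integral_cos_sum {T : ℝ} (hT : 0 < T) (k : ℕ) (θ : ℝ) :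
    ∫ t : Fin k → ℝ, Real.cos (θ * ∑ j, t j)
      ∂(Measure.pi fun _ => ProbabilityTheory.cond volume (Set.Icc 0 T)) =
      (uniformChar T θ ^ k).re := by
  have := isProbabilityMeasure_cond_Icc hT
  have h1 : uniformChar T θ ^ k = ∫ t : Fin k → ℝ, Complex.exp ((θ * ∑ j, t j : ℝ) * Complex.I)
      ∂(Measure.pi fun _ => ProbabilityTheory.cond volume (Set.Icc 0 T)) := by
    have h2 := integral_fin_nat_prod_eq_prod (n := k) (E := fun _ => ℝ)
      (μ := fun _ => ProbabilityTheory.cond volume (Set.Icc 0 T))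
      (fun _ (t : ℝ) => Complex.exp ((θ * t : ℝ) * Complex.I))
    rw [Finset.prod_const, Finset.card_univ, Fintype.card_fin] at h2
    rw [uniformChar, ← h2]
    refine integral_congr_ae (Filter.Eventually.of_forall fun t => ?_)
    simp only
    rw [← Complex.exp_sum, ← Finset.sum_mul, ← Complex.ofReal_sum, ← Finset.mul_sum]
  have hint : Integrable (fun t : Fin k → ℝ => Complex.exp ((θ * ∑ j, t j : ℝ) * Complex.I))
      (Measure.pi fun _ => ProbabilityTheory.cond volume (Set.Icc 0 T)) := by
    refine Integrable.of_bound (Continuous.aestronglyMeasurable (by fun_prop)) 1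
      (Filter.Eventually.of_forall fun t => ?_)
    rw [Complex.norm_exp_ofReal_mul_I]
  rw [h1, ← RCLike.re_eq_complex_re, ← integral_re hint]
  refine integral_congr_ae (Filter.Eventually.of_forall fun t => ?_)
  simp only [RCLike.re_eq_complex_re]
  rw [Complex.exp_ofReal_mul_I_re]

lemma norm_integral_cos_sum_le {T : ℝ} (hT : 0 < T) (k : ℕ) (θ : ℝ) :
    ‖∫ t : Fin k → ℝ, Real.cos (θ * ∑ j, t j)
      ∂(Measure.pi fun _ => ProbabilityTheory.cond volume (Set.Icc 0 T))‖ ≤ 1 := by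
  rw [integral_cos_sum hT]
  refine (Complex.abs_re_le_norm _).trans ?_
  rw [norm_pow]
  exact pow_le_one₀ (norm_nonneg _) (norm_uniformChar_le_one hT θ)

lemma norm_integral_cos_sum_le_pow {T : ℝ} (hT : 0 < T) (k : ℕ) {θ : ℝ} (hθ : 4 ≤ θ * T) :
    ‖∫ t : Fin k → ℝ, Real.cos (θ * ∑ j, t j)
      ∂(Measure.pi fun _ => ProbabilityTheory.cond volume (Set.Icc 0 T))‖ ≤ (1 / 2) ^ k := by
  have hθ0 : 0 < θ := pos_of_mul_pos_left (by linarith) hT.le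
  rw [integral_cos_sum hT]
  refine (Complex.abs_re_le_norm _).trans ?_
  rw [norm_pow]
  refine pow_le_pow_left₀ (norm_nonneg _) ((norm_uniformChar_le hT hθ0).trans ?_) k
  rw [div_le_div_iff₀ (by linarith) (by norm_num)]
  linarith

lemma integrable_cos_sum {T : ℝ} (hT : 0 < T) (k : ℕ) (θ : ℝ) :
    Integrable (fun t : Fin k → ℝ => Real.cos (θ * ∑ j, t j))
      (Measure.pi fun _ => ProbabilityTheory.cond volume (Set.Icc 0 T)) := by
  have := isProbabilityMeasure_cond_Icc hT
  refine Integrable.of_bound (Continuous.aestronglyMeasurable (by fun_prop)) 1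
    (Filter.Eventually.of_forall fun t => ?_)
  exact Real.abs_cos_le_one _

variable {X : Type*} [Fintype X] [DecidableEq X]
variable {P Q : Matrix X X ℝ} {σ : X → ℝ} {r : X → ℂ} {V : Matrix (X × X) (X × X) ℂ}

/-- The average over the evolution time of the bound `le_successProb`. -/
lemma le_avgSuccessProb {T : ℝ} (hT : 0 < T) (k : ℕ) (hr : ∑ y, ‖r y‖ ^ 2 = 1)
    (hV : IsWalkUnitary Q r V)
    (hQ : IsReversible Q σ) (hsymm : ∀ x y, 0 < P x y → 0 < P y x)
    (hedge : ∀ x y, Q x y ≠ 0 → 0 < P x y ∨ x = y) {φ : X → X → ℝ} {lam : X → ℝ}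
    (hb : IsEigenbasis (discriminant Q) φ lam) (a b : ℝ) (z : X → ℝ) (v : X) :
    a ^ 2 * σ v + 2 * a * b * √(σ v) *
      ∑ n, (φ n ⬝ᵥ z) * φ n v * ∫ t : Fin k → ℝ, Real.cos (√(1 - lam n ^ 2) * ∑ j, t j)
        ∂(Measure.pi fun _ => ProbabilityTheory.cond volume (Set.Icc 0 T)) ≤
    avgSuccessProb (searchHamiltonian P r V)
      (tensorKet (fun x => ((a * √(σ x) + b * z x : ℝ) : ℂ)) r) v k T := by
  have := isProbabilityMeasure_cond_Icc hT
  set μ := Measure.pi fun _ : Fin k => ProbabilityTheory.cond volume (Set.Icc 0 T) with hμ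
  have hterm : ∀ n, Integrable (fun t : Fin k → ℝ =>
      (φ n ⬝ᵥ z) * Real.cos (√(1 - lam n ^ 2) * ∑ j, t j) * φ n v) μ := fun n =>
    ((integrable_cos_sum hT k _).const_mul _).mul_const _
  have hsum : Integrable (fun t : Fin k → ℝ =>
      ∑ n, (φ n ⬝ᵥ z) * Real.cos (√(1 - lam n ^ 2) * ∑ j, t j) * φ n v) μ :=
    integrable_finsetSum _ fun n _ => hterm n
  have h1 : a ^ 2 * σ v + 2 * a * b * √(σ v) *
      ∑ n, (φ n ⬝ᵥ z) * φ n v * ∫ t : Fin k → ℝ, Real.cos (√(1 - lam n ^ 2) * ∑ j, t j) ∂μ =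
      ∫ t : Fin k → ℝ, (a ^ 2 * σ v + 2 * a * b * √(σ v) *
        ∑ n, (φ n ⬝ᵥ z) * Real.cos (√(1 - lam n ^ 2) * ∑ j, t j) * φ n v) ∂μ := by
    rw [integral_add (integrable_const _) (hsum.const_mul _), integral_const,
      integral_const_mul, integral_finsetSum _ fun n _ => hterm n]
    simp only [integral_mul_const, integral_const_mul, probReal_univ, one_smul]
    congr 2
    exact Finset.sum_congr rfl fun n _ => by ring
  rw [h1]
  refine integral_mono ((integrable_const _).add (hsum.const_mul _)) ?_ fun t =>
    le_successProb hr hV hQ hsymm hedge hb a b z v _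
  obtain ⟨K, hK⟩ := exists_successProb_le (r := r) (V := V) hsymm
    (tensorKet (fun x => ((a * √(σ x) + b * z x : ℝ) : ℂ)) r) v
  refine Integrable.of_bound ?_ K (Filter.Eventually.of_forall fun t => hK _)
  have hsumc : Continuous fun t : Fin k → ℝ => ∑ j, t j := by fun_prop
  exact ((continuous_successProb P r V _ v).comp hsumc).aestronglyMeasurable

end Average

/-! ### The interference term at the critical parameter -/

section Main

variable {X : Type*} [Fintype X] [DecidableEq X]

/-- The vector `z = √2 |v⟩ - |√σ⟩`; when `σ v = 1/2` it completes `|√σ⟩` to an orthonormal basis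
of the plane spanned by `|√σ⟩` and `|v⟩`. -/
def antiStationary (σ : X → ℝ) (v : X) : X → ℝ :=
  √2 • Pi.single v 1 - fun x => √(σ x)

lemma dotProduct_antiStationary (σ : X → ℝ) (v : X) (f : X → ℝ) :
    f ⬝ᵥ antiStationary σ v = √2 * f v - f ⬝ᵥ fun x => √(σ x) := by
  rw [antiStationary, dotProduct_sub, dotProduct_smul, dotProduct_single_one, smul_eq_mul]

lemma sqrt_two_mul_sqrt_half : √2 * √(1 / 2 : ℝ) = 1 := by
  rw [← Real.sqrt_mul (by norm_num)]
  norm_num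

variable {Q : Matrix X X ℝ} {σ : X → ℝ} {v : X}

lemma IsReversible.sqrt_dotProduct_antiStationary (hQ : IsReversible Q σ) (hv : σ v = 1 / 2) :
    (fun x => √(σ x)) ⬝ᵥ antiStationary σ v = 0 := by
  rw [dotProduct_antiStationary, hQ.sqrt_dotProduct_self, hv, sqrt_two_mul_sqrt_half, sub_self]

lemma IsReversible.antiStationary_dotProduct_self (hQ : IsReversible Q σ) (hv : σ v = 1 / 2) :
    antiStationary σ v ⬝ᵥ antiStationary σ v = 1 := by
  have h1 := hQ.sqrt_dotProduct_antiStationary hv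
  rw [dotProduct_antiStationary, dotProduct_comm _ (fun x => √(σ x)), h1, sub_zero]
  simp only [antiStationary, Pi.sub_apply, Pi.smul_apply, Pi.single_eq_same, smul_eq_mul, mul_one]
  rw [hv, mul_sub, sqrt_two_mul_sqrt_half, Real.mul_self_sqrt (by norm_num)]
  norm_num

/-- The phases `√(1 - λ²)` are at least `1 / (2 √M)` if `λ` keeps the distance `1 / (M + 1)`
from `1` and `1 / (4 M)` from `-1`. -/
lemma four_le_phase_mul {l M T : ℝ} (hM : 1 ≤ M) (h1 : 1 / (M + 1) ≤ 1 - l)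
    (h2 : -1 + 1 / (4 * M) ≤ l) (hT : T = 8 * √M) : 4 ≤ √(1 - l ^ 2) * T := by
  have hM0 : 0 < M := by linarith
  have h3 : 1 / (4 * M) ≤ 1 - l ^ 2 := by
    have h4 : 1 / (4 * M) ≤ 1 / (M + 1) := one_div_le_one_div_of_le (by linarith) (by linarith)
    have h5 : 0 < 1 / (4 * M) := by positivity
    rcases le_total 0 l with h | h <;> nlinarith
  have h6 : √(1 / (4 * M)) * √M = 1 / 2 := by
    rw [← Real.sqrt_mul (by positivity), show 1 / (4 * M) * M = (1 / 2) ^ 2 by field_simp; norm_num,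
      Real.sqrt_sq (by norm_num)]
  calc (4 : ℝ) = 8 * (√(1 / (4 * M)) * √M) := by rw [h6]; norm_num
    _ ≤ 8 * (√(1 - l ^ 2) * √M) := by gcongr
    _ = √(1 - l ^ 2) * T := by rw [hT]; ring

/-- The interference term of the averaged evolution. Eigenvalues away from `±1` contribute at most
`2 ^ (-k)`; those near `-1` are left over, and see little of the marked node. -/
lemma interference_le (hQ : IsReversible Q σ) (hv : σ v = 1 / 2) {φ : X → X → ℝ} {lam : X → ℝ}
    (hb : IsEigenbasis (discriminant Q) φ lam) {h : X → ℝ} {M : ℝ} (hM : 1 ≤ M)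
    (hh0 : ∀ x, 0 ≤ h x) (hhM : ∀ x, h x ≤ M)
    (hstep : ∀ x, x ≠ v → h x = 1 + ∑ y, Q x y * h y) {T : ℝ} (hT : T = 8 * √M) (k : ℕ) :
    √(σ v) * ∑ n, (φ n ⬝ᵥ antiStationary σ v) * φ n v *
        ∫ t : Fin k → ℝ, Real.cos (√(1 - lam n ^ 2) * ∑ j, t j)
          ∂(Measure.pi fun _ => ProbabilityTheory.cond volume (Set.Icc 0 T)) ≤
      (1 / 2) ^ k / 2 + ∑ n with lam n ≤ -1 + 1 / (4 * M), φ n v ^ 2 := by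
  have hM0 : 0 < M := by linarith
  have hT0 : 0 < T := by rw [hT]; positivity
  set z := antiStationary σ v with hz
  set I : X → ℝ := fun n => ∫ t : Fin k → ℝ, Real.cos (√(1 - lam n ^ 2) * ∑ j, t j)
    ∂(Measure.pi fun _ => ProbabilityTheory.cond volume (Set.Icc 0 T)) with hI
  have hκ : ∀ x, x ≠ v → ∑ y, Q x y * (h y + 1) ≤ (1 - 1 / (M + 1)) * (h x + 1) := by
    intro x hx
    have h1 : ∑ y, Q x y * (h y + 1) = h x := by
      simp_rw [mul_add, mul_one]
      rw [Finset.sum_add_distrib, hQ.row_sum, hstep x hx, add_comm]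
    have h2 : 1 / (M + 1) * (h x + 1) ≤ 1 := by
      rw [one_div_mul_eq_div, div_le_one (by linarith)]
      linarith [hhM x]
    rw [h1]
    linarith
  have hterm : ∀ n, √(σ v) * ((φ n ⬝ᵥ z) * φ n v * I n) ≤
      (φ n ⬝ᵥ z) ^ 2 * ((1 / 2) ^ k / 2) +
        if lam n ≤ -1 + 1 / (4 * M) then φ n v ^ 2 else 0 := by
    intro n
    have hif : 0 ≤ if lam n ≤ -1 + 1 / (4 * M) then φ n v ^ 2 else 0 := by
      split_ifs
      exacts [sq_nonneg _, le_rfl]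
    by_cases hn : φ n ⬝ᵥ z = 0
    · rw [hn]
      simpa using hif
    · obtain ⟨ho, hgap⟩ := hb.of_overlap_ne_zero hQ (κ := 1 / (M + 1)) (by positivity)
        (fun x => by linarith [hh0 x]) hκ (hQ.sqrt_dotProduct_antiStationary hv) hn
      have hζ : φ n ⬝ᵥ z = √2 * φ n v := by
        rw [hz, dotProduct_antiStationary, ho, sub_zero]
      have h2 : √(σ v) * ((φ n ⬝ᵥ z) * φ n v * I n) = φ n v ^ 2 * I n := by
        rw [hζ, hv]
        linear_combination (φ n v ^ 2 * I n) * sqrt_two_mul_sqrt_half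
      have h3 : (φ n ⬝ᵥ z) ^ 2 = 2 * φ n v ^ 2 := by
        rw [hζ, mul_pow, Real.sq_sqrt (by norm_num)]
      rw [h2, h3]
      split_ifs with hlow
      · have h4 : I n ≤ 1 := (le_abs_self _).trans (norm_integral_cos_sum_le hT0 k _)
        have h5 : 0 ≤ 2 * φ n v ^ 2 * ((1 / 2) ^ k / 2) := by positivity
        nlinarith [sq_nonneg (φ n v)]
      · have h4 : I n ≤ (1 / 2) ^ k := (le_abs_self _).trans
          (norm_integral_cos_sum_le_pow hT0 k (four_le_phase_mul hM hgap (not_le.1 hlow).le hT))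
        nlinarith [sq_nonneg (φ n v)]
  rw [Finset.mul_sum]
  refine (Finset.sum_le_sum fun n _ => hterm n).trans (le_of_eq ?_)
  rw [Finset.sum_add_distrib, ← Finset.sum_mul, hb.sum_sq, hQ.antiStationary_dotProduct_self hv,
    one_mul, Finset.sum_filter]

omit [Fintype X] in
/-- The initial state in the plane spanned by the stationary state and `z`. -/
lemma sqrt_stationary_eq {π : X → ℝ} (hv : π v ≤ 1 / 2) (x : X) :
    √(π x) = (√(π v) + √(1 - π v)) / √2 * √(criticalStationary π v x) +
      (√(π v) - √(1 - π v)) / √2 * antiStationary (criticalStationary π v) v x := by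
  have h2 : √2 ≠ 0 := by positivity
  have h2' : √2 * √2 = 2 := Real.mul_self_sqrt (by norm_num)
  by_cases hx : x = v
  · subst hx
    simp only [antiStationary, Pi.sub_apply, Pi.smul_apply, Pi.single_eq_same, smul_eq_mul,
      mul_one, criticalStationary_self]
    have h3 : √(1 / 2 : ℝ) = √2 / 2 := by
      have := sqrt_two_mul_sqrt_half
      linear_combination (√2 / 2) * this - (1 / 2) * √(1 / 2) * h2'
    rw [h3]
    field_simp
    ring
  · have hc : 0 < 1 - π v := by linarith
    have h3 : √(π x) = √2 * √(1 - π v) * √(criticalStationary π v x) := by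
      rw [← Real.sqrt_mul (by norm_num), ← Real.sqrt_mul (by linarith), criticalStationary,
        if_neg hx]
      congr 1
      field_simp
    simp only [antiStationary, Pi.sub_apply, Pi.smul_apply, Pi.single_eq_of_ne hx, smul_eq_mul,
      mul_zero, zero_sub]
    rw [h3]
    field_simp
    linear_combination (√(1 - π v) * √(criticalStationary π v x)) * h2'

lemma half_pow_ceil_logb_le {ε : ℝ} (hε : 0 < ε) :
    (1 / 2 : ℝ) ^ ⌈Real.logb 2 (1 / ε)⌉₊ ≤ ε := by
  have h1 : 1 / ε ≤ (2 : ℝ) ^ ⌈Real.logb 2 (1 / ε)⌉₊ := by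
    rw [← Real.rpow_natCast, ← Real.logb_le_iff_le_rpow (by norm_num) (by positivity)]
    exact Nat.le_ceil _
  rw [one_div_pow]
  exact (one_div_le (by positivity) hε).2 h1

lemma ceil_logb_le {ε : ℝ} (hε : 0 < ε) (hε' : ε < 1 / 4) :
    (⌈Real.logb 2 (1 / ε)⌉₊ : ℝ) ≤ 3 * Real.log (1 / ε) := by
  have h4 : 4 ≤ 1 / ε := by
    rw [le_div_iff₀ hε]
    linarith
  have h1 : 1 ≤ Real.logb 2 (1 / ε) := by
    rw [Real.le_logb_iff_rpow_le (by norm_num) (by positivity)]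
    norm_num
    rw [one_div] at h4
    linarith
  have h2 := (Nat.ceil_lt_add_one (zero_le_one.trans h1)).le
  have h3 : Real.logb 2 (1 / ε) * Real.log 2 = Real.log (1 / ε) := by
    rw [Real.logb, div_mul_cancel₀ _ (Real.log_pos (by norm_num)).ne']
  have h5 := Real.log_two_gt_d9
  nlinarith

/-! ### The averaged success probability -/

variable {P : Matrix X X ℝ} {r : X → ℂ} {V : Matrix (X × X) (X × X) ℂ}

/-- The quantitative core: a bounded solution `h` of the first-step equation is all that is used of
the hitting time. -/
lemma quarter_sub_le_avgSuccessProb (hP : P ∈ Matrix.rowStochastic ℝ X)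
    {π : X → ℝ} (hπ : π ∈ stdSimplex ℝ X) (hpos : ∀ x, 0 < π x)
    (hrev : ∀ x y, π x * P x y = π y * P y x) (hπv : π v ≤ 1 / 2) (hr : ∑ y, ‖r y‖ ^ 2 = 1)
    {s : ℝ} (hs : s = 1 - π v / (1 - π v)) (hV : IsWalkUnitary (interpolated P v s) r V)
    {h : X → ℝ} {M : ℝ} (hM : 1 ≤ M) (hv : h v = 0) (hh0 : ∀ x, 0 ≤ h x) (hhM : ∀ x, h x ≤ M)
    (hstep : ∀ x, x ≠ v → h x = 1 + ∑ y, P x y * h y) {T : ℝ} (hT : T = 8 * √M) (k : ℕ) :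
    1 / 4 - (1 / 2) ^ k ≤ avgSuccessProb (searchHamiltonian P r V)
      (tensorKet (fun x => ((√(π x) : ℝ) : ℂ)) r) v k T := by
  have hM0 : 0 < M := by linarith
  have hT0 : 0 < T := by rw [hT]; positivity
  have hp0 := hpos v
  have hc : 0 < 1 - π v := by linarith
  have hQ := isReversible_interpolated hP hπ hpos hrev hπv hs
  have hσv := criticalStationary_self π v
  have hs0 : 0 ≤ s := by
    rw [hs, sub_nonneg, div_le_one hc]
    linarith
  have hsymm : ∀ x y, 0 < P x y → 0 < P y x := fun x y hxy =>
    pos_of_mul_pos_right (hrev x y ▸ mul_pos (hpos x) hxy) (hpos y).le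
  have hedge : ∀ x y, interpolated P v s x y ≠ 0 → 0 < P x y ∨ x = y := by
    intro x y hxy
    by_cases hx : x = v
    · by_cases hy : y = v
      · exact Or.inr (hx.trans hy.symm)
      · subst hx
        rw [interpolated_self, Pi.single_eq_of_ne hy, mul_zero, add_zero] at hxy
        exact Or.inl (lt_of_le_of_ne (hP.1 _ _) (right_ne_zero_of_mul hxy).symm)
    · rw [interpolated_of_ne P s hx] at hxy
      exact Or.inl (lt_of_le_of_ne (hP.1 _ _) hxy.symm)
  obtain ⟨φ, lam, hb⟩ := exists_isEigenbasis
    (discriminant_isHermitian (Q := interpolated P v s))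
  have hmain := le_avgSuccessProb hT0 k hr hV hQ hsymm hedge hb
    ((√(π v) + √(1 - π v)) / √2) ((√(π v) - √(1 - π v)) / √2)
    (antiStationary (criticalStationary π v) v) v
  simp_rw [← sqrt_stationary_eq hπv] at hmain
  refine le_trans ?_ hmain
  have herr := interference_le hQ hσv hb hM hh0 hhM
    (fun x hx => by simp_rw [interpolated_of_ne P s hx]; exact hstep x hx) hT k
  have hloop := hb.two_mul_loop_mul_sum_le hQ v (δ := 1 / (4 * M)) (by positivity)
    (Finset.univ.filter fun n => lam n ≤ -1 + 1 / (4 * M))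
    (fun n hn => (Finset.mem_filter.1 hn).2)
  set W := ∑ n with lam n ≤ -1 + 1 / (4 * M), φ n v ^ 2 with hW
  have hW0 : 0 ≤ W := Finset.sum_nonneg fun n _ => sq_nonneg _
  -- the loop that the interpolation puts at `v` has weight at least `s`
  have hQvv : s ≤ interpolated P v s v v := by
    rw [interpolated_self, Pi.single_eq_same, mul_one]
    refine le_add_of_nonneg_left (mul_nonneg ?_ (hP.1 v v))
    rw [hs, sub_sub_cancel]
    positivity
  have hsW : 2 * s * W ≤ 1 / (4 * M) := le_trans (by gcongr) hloop
  have hs1 : 1 - 2 * π v = s * (1 - π v) := by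
    rw [hs]
    field_simp
    ring
  have hpW : (1 - 2 * π v) * W ≤ 1 / (8 * M) := by
    have h1 : s * W ≤ 1 / (8 * M) := by
      have : 1 / (8 * M) = 1 / (4 * M) / 2 := by field_simp; norm_num
      linarith
    have h2 : 0 ≤ s * W := mul_nonneg hs0 hW0
    rw [hs1]
    nlinarith
  -- the overlap of the initial state with the stationary state exceeds `1/2` by a margin of the
  -- order of `√(π v)`, which absorbs the eigenvalues near `-1`
  have hsurplus : 1 / (4 * M) ≤ √(π v) * √(1 - π v) := by
    have h1 := one_sub_stationary_le hP hπ hrev hv hstep hhM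
    have h2 : 1 / (4 * M) ≤ π v * (1 - π v) := by
      rw [div_le_iff₀ (by positivity)]
      nlinarith
    rw [← Real.sqrt_mul hp0.le]
    refine Real.le_sqrt_of_sq_le (le_trans ?_ h2)
    rw [sq]
    refine mul_le_of_le_one_left (by positivity) ?_
    rw [div_le_one (by positivity)]
    linarith
  have hsq2 : √2 ^ 2 = (2 : ℝ) := Real.sq_sqrt (by norm_num)
  have hsqp := Real.sq_sqrt hp0.le
  have hsqc := Real.sq_sqrt hc.le
  have ha : ((√(π v) + √(1 - π v)) / √2) ^ 2 = (1 + 2 * (√(π v) * √(1 - π v))) / 2 := by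
    rw [div_pow, hsq2]
    linear_combination (1 / 2) * hsqp + (1 / 2) * hsqc
  have hab : 2 * ((√(π v) + √(1 - π v)) / √2) * ((√(π v) - √(1 - π v)) / √2) =
      -(1 - 2 * π v) := by
    have : 2 * ((√(π v) + √(1 - π v)) / √2) * ((√(π v) - √(1 - π v)) / √2) =
        2 * (√(π v) ^ 2 - √(1 - π v) ^ 2) / √2 ^ 2 := by ring
    rw [this, hsq2, hsqp, hsqc]
    ring
  rw [ha, hab, mul_assoc]
  generalize √(criticalStationary π v v) * _ = R at herr ⊢
  rw [hσv]
  have hp2 : 0 ≤ 1 - 2 * π v := by linarith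
  have h8 : 1 / (4 * M) = 2 * (1 / (8 * M)) := by field_simp; norm_num
  have hk : (0 : ℝ) ≤ (1 / 2) ^ k := by positivity
  have h1 := mul_le_mul_of_nonneg_left herr hp2
  have h2 : (1 - 2 * π v) * ((1 / 2 : ℝ) ^ k / 2) ≤ (1 / 2) ^ k / 2 :=
    mul_le_of_le_one_left (by positivity) (by linarith)
  linarith

end Main

end QSearch

end

theorem mainTheorem2 :
    ∃ C > (0 : ℝ), ∃ C' > (0 : ℝ),
      ∀ (X : Type*) [Fintype X] [DecidableEq X] [MeasurableSpace X] [DiscreteMeasurableSpace X]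
        (P : Matrix X X ℝ) (hP : P ∈ Matrix.rowStochastic ℝ X) (_ : P.IsPrimitive)
        (π : X → ℝ) (_ : π ∈ stdSimplex ℝ X) (_ : ∀ x y, π x * P x y = π y * P y x)
        (v : X) (_ : π v ≤ 1 / 2)
        (r : X → ℂ) (_ : ∑ y, ‖r y‖ ^ 2 = 1)
        (s : ℝ) (_ : s = 1 - π v / (1 - π v))
        (V : Matrix (X × X) (X × X) ℂ)
        (_ : QSearch.IsWalkUnitary (QSearch.interpolated P v s) r V)
        (ε : ℝ) (_ : 0 < ε) (_ : ε < 1 / 4)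
        (k : ℕ) (_ : k = ⌈Real.logb 2 (1 / ε)⌉₊)
        (T : ℝ) (_ : T = C * √(QSearch.hittingTime P hP v).toReal),
        QSearch.hittingTime P hP v < ⊤ ∧ 0 < T ∧
        k * T ≤ C' * √(QSearch.hittingTime P hP v).toReal * Real.log (1 / ε) ∧
        1 / 4 - ε ≤ QSearch.avgSuccessProb (QSearch.searchHamiltonian P r V)
          (QSearch.tensorKet (fun x => ((√(π x) : ℝ) : ℂ)) r) v k T := by
  refine ⟨8, by norm_num, 24, by norm_num, ?_⟩
  intro X _ _ _ _ P hP hprim π hπ hrev v hπv r hr s hs V hV ε hε hε' k hk T hT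
  have hpos := QSearch.stationary_pos hP hprim hπ hrev
  have hne : ∃ x, x ≠ v := by
    by_contra hall
    push Not at hall
    have h1 := hπ.2
    rw [Finset.sum_eq_single v (fun x _ hx => absurd (hall x) hx) (by simp)] at h1
    linarith
  obtain ⟨h, hv, hh0, hstep, hfin, hhM, hM⟩ :=
    QSearch.exists_hittingTime_potential hP hprim v hne
  have hsqrt : 0 < √(QSearch.hittingTime P hP v).toReal := Real.sqrt_pos.2 (by linarith)
  refine ⟨hfin, by rw [hT]; positivity, ?_, ?_⟩
  · have h1 := QSearch.ceil_logb_le hε hε'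
    rw [← hk] at h1
    rw [hT]
    nlinarith
  · have h1 := QSearch.half_pow_ceil_logb_le hε
    rw [← hk] at h1
    refine le_trans (by linarith) (QSearch.quarter_sub_le_avgSuccessProb hP hπ hpos hrev hπv hr
      hs hV hM hv hh0 hhM hstep hT k)
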